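/- Let i.i.d. marks, uniform on $[0,1]$, be observed at the times of an independent homogeneous Poisson process of intensity $\nu>0$ on $[0,1]$. A (feasible) control is a measurable function $\psi$ with $0\le\psi(t,x)\le 1-x$ for $(t,x)\in[0,1]^2$; under it, a mark $x'$ observed at time $t$ is selected if and only if $x<x'\le x+\psi(t,x)$, where $x$ is the last mark selected before time $t$ ($x=0$ if there is none). Let $X(t)$ be the last mark selected in $[0,t]$ (with $X(t)=0$ if there is none), $L(t)$ the number of marks selected in $[0,t]$, and $p(t)=\mathbb E X(t)$. For constants $\beta_->0$ and $\beta_+\ge 0$, consider the condition $$\sqrt{\frac{2(1-x)}{\nu(1-t)}}-\frac{\beta_-}{\nu(1-t)}\le\psi(t,x)\le\sqrt{\frac{2(1-x)}{\nu(1-t)}}+\frac{\beta_+}{\nu(1-t)},\qquad t,x\in[0,1).\qquad(*)$$ 1. For all $\beta_->0$, $\beta_+\ge0$ and $c_+>2-\sqrt3$ there is $\nu_0>0$ such that, for every $\nu\ge\nu_0$ and every feasible control $\psi$ satisfying $(*)$, $$-\frac{3\beta_-}{\sqrt\nu}\le p(t)-t\le\frac{\beta_+\sqrt2\,t}{\sqrt\nu}+\frac{c_+\beta_+^2}{2\nu}\qquad\text{for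 all }t\in[0,1].$$ 2. If $(\psi_\nu)$ is a family of feasible controls such that, for fixed $\beta_->0$ and $\beta_+\ge0$, $\psi_\nu$ satisfies $(*)$ at intensity $\nu$ for all large $\nu$, then $\sup_{t\in[0,1]}|p(t)-t|=O(\nu^{-1/2})$ as $\nu\to\infty$. 3. For every $\nu>0$, if $\psi$ is an optimal control, that is, it maximises $\mathbb E L(1)$ among all feasible controls at intensity $\nu$, then $p(t)\le t$ for all $t\in[0,1]$. -/

import Mathlib

open Real Set Filter MeasureTheory ProbabilityTheory
open scoped unitInterval

noncomputable section

namespace OnlineSelection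

/-- A sample point: for each `n`, the time gap before item `n` and the mark of item `n`. -/
abbrev Sample : Type := ℕ → ℝ × I

/-- The law of the observations at intensity `ν`: all gaps and marks are independent, the gaps are
exponential with rate `ν` (so the observation times form a homogeneous Poisson process of
intensity `ν`), and the marks are uniform on `[0,1]`. -/
def sampleLaw (ν : ℝ) : Measure Sample :=
  Measure.infinitePi fun _ : ℕ => (expMeasure ν).prod (volume : Measure I)

/-- Time at which item `n` (counted from `0`) is observed. -/
def arrival (ω : Sample) (n : ℕ) : ℝ := ∑ k ∈ Finset.range (n + 1), (ω k).1

/-- The mark of item `n`. -/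
def mark (ω : Sample) (n : ℕ) : ℝ := ((ω n).2 : ℝ)

/-- The number of items observed in the time interval `[0,t]`. -/
def arrivalCount (ω : Sample) (t : ℝ) : ℕ := {n : ℕ | arrival ω n ≤ t}.ncard

open Classical in
/-- The last selected mark (initially `0`) and the number of selected marks after the first `n`
items have been processed with the control `ψ`: the next item, observed at time `s` with mark
`x'`, is selected if and only if `x < x' ≤ x + ψ s x`, with `x` the last selected mark. -/
def chain (ψ : ℝ → ℝ → ℝ) (ω : Sample) : ℕ → ℝ × ℕ
  | 0 => (0, 0)
  | n + 1 =>
    let c := chain ψ ω n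
    if c.1 < mark ω n ∧ mark ω n ≤ c.1 + ψ (arrival ω n) c.1 then (mark ω n, c.2 + 1) else c

/-- The running maximum `X(t)`: the last mark selected in the time interval `[0,t]`. -/
def runningMax (ψ : ℝ → ℝ → ℝ) (t : ℝ) (ω : Sample) : ℝ :=
  (chain ψ ω (arrivalCount ω t)).1

/-- The length process `L(t)`: the number of marks selected in the time interval `[0,t]`. -/
def lengthProcess (ψ : ℝ → ℝ → ℝ) (t : ℝ) (ω : Sample) : ℕ :=
  (chain ψ ω (arrivalCount ω t)).2

/-- The mean running maximum `p(t) = E X(t)` at intensity `ν`. -/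
def meanMax (ψ : ℝ → ℝ → ℝ) (ν t : ℝ) : ℝ := ∫ ω, runningMax ψ t ω ∂sampleLaw ν

/-- The mean length `E L(t)` at intensity `ν`. -/
def meanLength (ψ : ℝ → ℝ → ℝ) (ν t : ℝ) : ℝ := ∫ ω, (lengthProcess ψ t ω : ℝ) ∂sampleLaw ν

/-- Feasible controls: measurable, nonnegative, and never selecting outside the unit square. -/
structure Feasible (ψ : ℝ → ℝ → ℝ) : Prop where
  measurable : Measurable (Function.uncurry ψ)
  nonneg : ∀ t ∈ Icc (0 : ℝ) 1, ∀ x ∈ Icc (0 : ℝ) 1, 0 ≤ ψ t x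
  le : ∀ t ∈ Icc (0 : ℝ) 1, ∀ x ∈ Icc (0 : ℝ) 1, ψ t x ≤ 1 - x

/-- The squeeze of the control around `√(2(1-x)/(ν(1-t)))` with constants `βm = β₋`, `βp = β₊`. -/
def Squeezed (βm βp ν : ℝ) (ψ : ℝ → ℝ → ℝ) : Prop :=
  ∀ t ∈ Ico (0 : ℝ) 1, ∀ x ∈ Ico (0 : ℝ) 1,
    √(2 * (1 - x) / (ν * (1 - t))) - βm / (ν * (1 - t)) ≤ ψ t x ∧
      ψ t x ≤ √(2 * (1 - x) / (ν * (1 - t))) + βp / (ν * (1 - t))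

/-- `ψ` is an optimal strategy at intensity `ν`: it maximises the expected total length `E L(1)`
over feasible controls. -/
def IsOptimal (ν : ℝ) (ψ : ℝ → ℝ → ℝ) : Prop :=
  Feasible ψ ∧ ∀ φ : ℝ → ℝ → ℝ, Feasible φ → meanLength φ ν 1 ≤ meanLength ψ ν 1

end OnlineSelection

end

open Real Set Filter MeasureTheory ProbabilityTheory
open scoped unitInterval ENNReal

noncomputable section

namespace OnlineSelection

/-! Write `X` for the running maximum and `p` for its mean. Marks are selected at rate `ν ψ` and
raise `X` by `ψ / 2` on average, so `p' = E[ν ψ(s, X)² / 2]`. On the critical curve `ψ² = 2(1 - x) /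
(ν(1 - s))` this reads `p' = (1 - p) / (1 - s)`, `p(0) = 0`, whose solution is `p(t) = t`. The
theorem perturbs this equation.

Squeezed controls. Put `W = √((1 - X) / (1 - s))` and `b = β√2 / √ν`. Squaring the squeeze bounds `ν
ψ² / 2` above by `W² + bW / (1 - s) + b² / (4(1 - s)²)` and below by `W² - bW / (1 - s)`. The mean
of `W²` is explicit, and Jensen's inequality `E W ≤ √(E W²)` has the right direction in both bounds.
Hence `p` satisfies closed differential inequalities, which `le_of_crossing` compares with explicit
barriers (`upper_barrier`, `lower_barrier`). The constant `2 - √3` is the maximum of the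
second-order correction in the upper barrier.

Optimal controls. The value function `V` solves `V' = gain V`. The value of the remaining rectangle,
`V(ν(1 - s)(1 - x))`, telescopes along a path from `V(ν)` to `0`, and the compensation formula turns
this into an identity for every feasible control (`ofReal_value`): the mean of decay plus jump rate
integrates to `V(ν)`. Pointwise `ν ψ ≤ decay + jumpRate`, with equality for `greedyControl`. So
`V(ν)` is the maximal mean length, and an optimal control has equality almost everywhere along its
own trajectory. As `V` is concave, equality puts the control below the critical curve
(`sq_le_of_rate_eq`), and the upper barrier with `b = 0` gives `p(t) ≤ t`.

Concavity of `V`. The function `(t, h) ↦ V(t h)` is the limit of Duhamel iterates of the equation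
for a strip of height `h`, and each iteration preserves diminishing increments in `h`
(`Diminishing.add_stripGain`). -/

/-! ### The value function as a fixed point -/

/-- The right-hand side of the optimality equation `V' = Φ V` for the value function. -/
def gain (V : ℝ → ℝ) (w : ℝ) : ℝ := ∫ y in (0 : ℝ)..1, max (1 + V (w * (1 - y)) - V w) 0

lemma continuous_gain {V : ℝ → ℝ} (hV : Continuous V) : Continuous (gain V) := by
  unfold gain
  apply intervalIntegral.continuous_parametric_intervalIntegral_of_continuous'
  fun_prop

lemma abs_gain_sub_le {V W : ℝ → ℝ} (hV : Continuous V) (hW : Continuous W) {w C : ℝ}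
    (h : ∀ x, |x| ≤ |w| → |V x - W x| ≤ C) : |gain V w - gain W w| ≤ 2 * C := by
  unfold gain
  rw [← intervalIntegral.integral_sub (Continuous.intervalIntegrable (by fun_prop) _ _)
    (Continuous.intervalIntegrable (by fun_prop) _ _)]
  have := intervalIntegral.norm_integral_le_of_norm_le_const (a := 0) (b := 1) (C := 2 * C)
    (f := fun y => max (1 + V (w * (1 - y)) - V w) 0 - max (1 + W (w * (1 - y)) - W w) 0) ?_
  · simpa using this
  intro y hy
  rw [uIoc_of_le zero_le_one] at hy
  have h1 := h w le_rfl
  have h2 := h (w * (1 - y)) (by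
    rw [abs_mul, abs_of_nonneg (by linarith [hy.2] : 0 ≤ 1 - y)]
    nlinarith [abs_nonneg w, hy.1])
  rw [Real.norm_eq_abs]
  refine (abs_max_sub_max_le_abs _ _ _).trans ?_
  rw [abs_le] at *
  constructor <;> linarith [h1.1, h1.2, h2.1, h2.2]

/-- With the weight `exp (3 z)`, integration from `0` has norm at most `1/3`. Against the Lipschitz
constant `2` of `gain` this leaves the contraction factor `2/3`. -/
lemma exp_neg_mul_abs_integral_le {f : ℝ → ℝ} {C z : ℝ} (hC : 0 ≤ C) (hz : 0 ≤ z)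
    (h : ∀ w, 0 ≤ w → |f w| ≤ C * exp (3 * w)) :
    exp (-(3 * z)) * |∫ w in (0 : ℝ)..z, f w| ≤ C / 3 := by
  have h1 : |∫ w in (0 : ℝ)..z, f w| ≤ ∫ w in (0 : ℝ)..z, C * exp (3 * w) := by
    rw [← Real.norm_eq_abs]
    refine intervalIntegral.norm_integral_le_of_norm_le hz ?_
      (Continuous.intervalIntegrable (by fun_prop) _ _)
    exact Eventually.of_forall fun w hw => h w hw.1.le
  have h2 : ∫ w in (0 : ℝ)..z, C * exp (3 * w) = C * ((exp (3 * z) - 1) / 3) := by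
    rw [intervalIntegral.integral_const_mul]
    congr 1
    simp
    ring
  rw [h2] at h1
  calc exp (-(3 * z)) * |∫ w in (0 : ℝ)..z, f w|
      ≤ exp (-(3 * z)) * (C * ((exp (3 * z) - 1) / 3)) := by gcongr
    _ = C / 3 * (exp (-(3 * z)) * exp (3 * z) - exp (-(3 * z))) := by ring
    _ = C / 3 * (1 - exp (-(3 * z))) := by rw [← exp_add]; simp
    _ ≤ C / 3 := by nlinarith [exp_pos (-(3 * z))]

lemma gain_zero (w : ℝ) : gain (fun _ => 0) w = 1 := by simp [gain]

/-- The weighted Picard operator for the optimality equation. -/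
def picard (U : BoundedContinuousFunction ℝ ℝ) : BoundedContinuousFunction ℝ ℝ :=
  BoundedContinuousFunction.ofNormedAddCommGroup
    -- The weight keeps the iterates bounded, and `|z|` extends the half-line problem to all of `ℝ`.
    (fun z => exp (-(3 * |z|)) * ∫ w in (0 : ℝ)..|z|, gain (fun x => exp (3 * |x|) * U x) w)
    (by
      have := continuous_gain (V := fun x => exp (3 * |x|) * U x) (by fun_prop)
      have h2 : Continuous fun z : ℝ => ∫ w in (0 : ℝ)..|z|, gain (fun x => exp (3 * |x|) * U x) w :=
        intervalIntegral.continuous_parametric_intervalIntegral_of_continuous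
          (f := fun _ : ℝ => gain (fun x => exp (3 * |x|) * U x)) (by fun_prop) (by fun_prop)
      fun_prop)
    ((1 + 2 * ‖U‖) / 3)
    (by
      intro z
      rw [Real.norm_eq_abs, abs_mul, abs_of_pos (exp_pos _)]
      refine exp_neg_mul_abs_integral_le (by positivity) (abs_nonneg z) fun w hw => ?_
      have h1 := abs_gain_sub_le (V := fun x => exp (3 * |x|) * U x) (W := fun _ => 0)
        (by fun_prop) (by fun_prop) (w := w) (C := exp (3 * w) * ‖U‖) (by
          intro x hx
          rw [abs_of_nonneg hw] at hx
          rw [sub_zero, abs_mul, abs_of_pos (exp_pos _)]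
          have := U.norm_coe_le_norm x
          rw [Real.norm_eq_abs] at this
          gcongr)
      rw [gain_zero] at h1
      have h2 : 1 ≤ exp (3 * w) := one_le_exp (by positivity)
      rw [abs_le] at *
      constructor <;> nlinarith [norm_nonneg U, h1.1, h1.2])

lemma picard_contracting : ContractingWith (2 / 3) picard := by
  refine ⟨by rw [div_lt_one (by norm_num)]; norm_num, LipschitzWith.of_dist_le_mul fun U W => ?_⟩
  rw [BoundedContinuousFunction.dist_le (by positivity)]
  intro z
  have hc (U : BoundedContinuousFunction ℝ ℝ) := continuous_gain (V := fun x => exp (3 * |x|) * U x) (by fun_prop)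
  have h := exp_neg_mul_abs_integral_le
    (f := fun w => gain (fun x => exp (3 * |x|) * U x) w - gain (fun x => exp (3 * |x|) * W x) w)
    (C := 2 * dist U W) (by positivity) (abs_nonneg z) (by
      intro w hw
      refine (abs_gain_sub_le (C := exp (3 * w) * dist U W) (by fun_prop) (by fun_prop) ?_).trans_eq (by ring)
      intro x hx
      rw [abs_of_nonneg hw] at hx
      rw [← mul_sub, abs_mul, abs_of_pos (exp_pos _), ← Real.dist_eq]
      have := BoundedContinuousFunction.dist_coe_le_dist (f := U) (g := W) x
      gcongr)
  rw [intervalIntegral.integral_sub ((hc U).intervalIntegrable _ _) ((hc W).intervalIntegrable _ _)] at h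
  rw [Real.dist_eq]
  simp only [picard, BoundedContinuousFunction.coe_ofNormedAddCommGroup]
  rw [← mul_sub, abs_mul, abs_of_pos (exp_pos _)]
  push_cast
  linarith

/-- The value function: `value z` is the maximal mean length of a sequence selected from a
rectangle in which the mean number of items is `z`. -/
def value (z : ℝ) : ℝ := exp (3 * |z|) * picard_contracting.fixedPoint picard z

lemma continuous_value : Continuous value := by unfold value; fun_prop

lemma continuous_gain_value : Continuous (gain value) := continuous_gain continuous_value

lemma value_eq {z : ℝ} (hz : 0 ≤ z) : value z = ∫ w in (0 : ℝ)..z, gain value w := by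
  have h := DFunLike.congr_fun (picard_contracting.fixedPoint_isFixedPt).eq z
  unfold value
  conv_lhs => rw [← h]
  simp only [picard, BoundedContinuousFunction.coe_ofNormedAddCommGroup, abs_of_nonneg hz]
  rw [← mul_assoc, ← exp_add]
  simp

@[simp] lemma value_zero : value 0 = 0 := by rw [value_eq le_rfl]; simp

lemma gain_nonneg (V : ℝ → ℝ) (w : ℝ) : 0 ≤ gain V w :=
  intervalIntegral.integral_nonneg zero_le_one fun _ _ => le_max_right _ _

lemma hasDerivAt_value {z : ℝ} (hz : 0 < z) : HasDerivAt value (gain value z) z := by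
  have h := intervalIntegral.integral_hasDerivAt_right (a := 0) (b := z)
    (continuous_gain_value.intervalIntegrable _ _)
    (continuous_gain_value.stronglyMeasurableAtFilter _ _) continuous_gain_value.continuousAt
  refine h.congr_of_eventuallyEq ?_
  filter_upwards [lt_mem_nhds hz] with x hx using value_eq hx.le

lemma value_mono {x y : ℝ} (hx : 0 ≤ x) (hxy : x ≤ y) : value x ≤ value y := by
  rw [value_eq hx, value_eq (hx.trans hxy)]
  refine intervalIntegral.integral_mono_interval le_rfl hx hxy ?_
    (continuous_gain_value.intervalIntegrable _ _)
  exact Eventually.of_forall fun w => gain_nonneg _ _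

lemma value_nonneg {x : ℝ} (hx : 0 ≤ x) : 0 ≤ value x := by
  simpa using value_mono le_rfl hx

lemma gain_value_le_one {w : ℝ} (hw : 0 ≤ w) : gain value w ≤ 1 := by
  have : gain value w ≤ ∫ y in (0 : ℝ)..1, (1 : ℝ) := by
    refine intervalIntegral.integral_mono_on zero_le_one
      (Continuous.intervalIntegrable (by have := continuous_value; fun_prop) _ _) (by simp) ?_
    intro y hy
    have := value_mono (x := w * (1 - y)) (y := w) (mul_nonneg hw (by linarith [hy.2]))
      (by nlinarith [hy.1])
    exact max_le (by linarith) zero_le_one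
  simpa using this

lemma value_le {z : ℝ} (hz : 0 ≤ z) : value z ≤ z := by
  rw [value_eq hz]
  have : ∫ w in (0 : ℝ)..z, gain value w ≤ ∫ w in (0 : ℝ)..z, (1 : ℝ) :=
    intervalIntegral.integral_mono_on hz (continuous_gain_value.intervalIntegrable _ _) (by simp)
      fun w hw => gain_value_le_one hw.1
  simpa using this

/-! ### Concavity of the value function -/

/-- Continuous functions that are nondecreasing with diminishing increments on `[0,1]`. -/
structure Diminishing (w : ℝ → ℝ) : Prop where
  continuous : Continuous w
  mono : ∀ h k, 0 ≤ h → h ≤ k → k ≤ 1 → w h ≤ w k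
  incr : ∀ h k d, 0 ≤ h → h ≤ k → 0 ≤ d → k + d ≤ 1 → w (k + d) - w k ≤ w (h + d) - w h

/-- The rate of increase of the value `w h` of a strip of height `h`. -/
def stripGain (w : ℝ → ℝ) (h : ℝ) : ℝ := ∫ r in (0 : ℝ)..h, max (1 + w r - w h) 0

/-- The length of the acceptance window when levels are valued by `w` and `c` is to be exceeded. -/
def window (w : ℝ → ℝ) (c h : ℝ) : ℝ := ∫ r in (0 : ℝ)..h, if c - w r < 1 then 1 else 0

lemma intervalIntegrable_window {w : ℝ → ℝ} (hw : Continuous w) (c a b : ℝ) :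
    IntervalIntegrable (fun r => if c - w r < 1 then (1 : ℝ) else 0) volume a b := by
  have hm : Measurable fun r => if c - w r < 1 then (1 : ℝ) else 0 :=
    Measurable.ite (measurableSet_lt (by fun_prop) (by fun_prop)) (by fun_prop) (by fun_prop)
  refine (intervalIntegrable_const (c := (1 : ℝ))).mono_fun hm.aestronglyMeasurable ?_
  refine Eventually.of_forall fun r => ?_
  dsimp only
  split_ifs <;> simp

lemma window_le {w : ℝ → ℝ} (hw : Continuous w) (c : ℝ) {h : ℝ} (hh : 0 ≤ h) :
    window w c h ≤ h := by
  have : window w c h ≤ ∫ r in (0 : ℝ)..h, (1 : ℝ) := by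
    refine intervalIntegral.integral_mono_on hh (intervalIntegrable_window hw _ _ _) (by simp) ?_
    intro r _
    split_ifs <;> simp
  simpa using this

lemma stripGain_sub {w : ℝ → ℝ} (hw : Continuous w) (h k : ℝ) :
    stripGain w k - stripGain w h =
      (∫ r in (0 : ℝ)..h, (max (1 + w r - w k) 0 - max (1 + w r - w h) 0)) +
        ∫ r in h..k, max (1 + w r - w k) 0 := by
  unfold stripGain
  rw [intervalIntegral.integral_sub (Continuous.intervalIntegrable (by fun_prop) _ _)
    (Continuous.intervalIntegrable (by fun_prop) _ _),
    ← intervalIntegral.integral_add_adjacent_intervals (a := 0) (b := h) (c := k)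
      (Continuous.intervalIntegrable (by fun_prop) _ _)
      (Continuous.intervalIntegrable (by fun_prop) _ _)]
  ring

/-- Increment form of the formal derivative `1 - w' · window`. Raising the top level lowers the
integrand by at most the increment of `w`, and only where it was positive, that is, on the window of
the lower level. The reverse bound `stripGain_sub_le` uses the window of the upper level. -/
lemma le_stripGain_sub {w : ℝ → ℝ} (hw : Diminishing w) {h k : ℝ} (hh : 0 ≤ h) (hk : h ≤ k)
    (k1 : k ≤ 1) :
    -(w k - w h) * window w (w h) h + (k - h) * (1 - (w k - w h)) ≤
      stripGain w k - stripGain w h := by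
  have hc := hw.continuous
  have hm := hw.mono h k hh hk k1
  rw [stripGain_sub hc]
  refine add_le_add ?_ ?_
  · unfold window
    rw [← intervalIntegral.integral_const_mul]
    refine intervalIntegral.integral_mono_on hh ((intervalIntegrable_window hc _ _ _).const_mul _)
      (Continuous.intervalIntegrable (by fun_prop) _ _) ?_
    intro r hr
    split_ifs with h1
    · rw [max_eq_left (by linarith : 0 ≤ 1 + w r - w h)]
      linarith [le_max_left (1 + w r - w k) 0]
    · rw [max_eq_right (by linarith : 1 + w r - w h ≤ 0)]
      simp
  · have : ∫ r in h..k, (1 - (w k - w h)) ≤ ∫ r in h..k, max (1 + w r - w k) 0 := by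
      refine intervalIntegral.integral_mono_on hk (by simp)
        (Continuous.intervalIntegrable (by fun_prop) _ _) ?_
      intro r hr
      have := hw.mono h r hh hr.1 (hr.2.trans k1)
      exact le_max_of_le_left (by linarith)
    rwa [intervalIntegral.integral_const, smul_eq_mul] at this

lemma stripGain_sub_le {w : ℝ → ℝ} (hw : Diminishing w) {h k : ℝ} (hh : 0 ≤ h) (hk : h ≤ k)
    (k1 : k ≤ 1) :
    stripGain w k - stripGain w h ≤ -(w k - w h) * window w (w k) h + (k - h) := by
  have hc := hw.continuous
  have hm := hw.mono h k hh hk k1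
  rw [stripGain_sub hc]
  refine add_le_add ?_ ?_
  · unfold window
    rw [← intervalIntegral.integral_const_mul]
    refine intervalIntegral.integral_mono_on hh
      (Continuous.intervalIntegrable (by fun_prop) _ _)
      ((intervalIntegrable_window hc _ _ _).const_mul _) ?_
    intro r hr
    split_ifs with h1
    · rw [max_eq_left (by linarith : 0 ≤ 1 + w r - w k)]
      linarith [le_max_left (1 + w r - w h) 0]
    · rw [max_eq_right (by linarith : 1 + w r - w k ≤ 0)]
      simp
  · have : ∫ r in h..k, max (1 + w r - w k) 0 ≤ ∫ r in h..k, (1 : ℝ) := by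
      refine intervalIntegral.integral_mono_on hk 
        (Continuous.intervalIntegrable (by fun_prop) _ _) (by simp) ?_
      intro r hr
      have := hw.mono r k (hh.trans hr.1) hr.2 k1
      exact max_le (by linarith) zero_le_one
    simpa using this

/-- Acceptance windows do not shrink as the strip grows: translation by `k + d - h` maps the window
below `h` into the window below `k + d`, because increments of `w` diminish. The loss `d` pays for
the part landing in `[k, k + d]`. -/
lemma window_sub_le {w : ℝ → ℝ} (hw : Diminishing w) {h k d : ℝ} (hh : 0 ≤ h) (hk : h ≤ k)
    (hd : 0 ≤ d) (hkd : k + d ≤ 1) : window w (w h) h - d ≤ window w (w (k + d)) k := by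
  have hc := hw.continuous
  have hnn : ∀ c r, (0 : ℝ) ≤ if c - w r < 1 then 1 else 0 := fun c r => by split_ifs <;> simp
  rcases le_total h d with hhd | hhd
  · have h1 := window_le hc (w h) hh
    have h2 : 0 ≤ window w (w (k + d)) k :=
      intervalIntegral.integral_nonneg (hh.trans hk) fun r _ => hnn _ _
    linarith
  · have e1 : window w (w h) h = (∫ r in (0 : ℝ)..(h - d), if w h - w r < 1 then (1 : ℝ) else 0) +
        ∫ r in (h - d)..h, if w h - w r < 1 then (1 : ℝ) else 0 :=
      (intervalIntegral.integral_add_adjacent_intervals (intervalIntegrable_window hc _ _ _)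
        (intervalIntegrable_window hc _ _ _)).symm
    have e2 : ∫ r in (h - d)..h, (if w h - w r < 1 then (1 : ℝ) else 0) ≤
        ∫ r in (h - d)..h, (1 : ℝ) := by
      refine intervalIntegral.integral_mono_on (by linarith) (intervalIntegrable_window hc _ _ _)
        (by simp) fun r _ => ?_
      split_ifs <;> simp
    have e3 : ∫ r in (0 : ℝ)..(h - d), (if w h - w r < 1 then (1 : ℝ) else 0) ≤
        ∫ r in (0 : ℝ)..(h - d), if w (k + d) - w (r + (k + d - h)) < 1 then (1 : ℝ) else 0 := by
      refine intervalIntegral.integral_mono_on (by linarith) (intervalIntegrable_window hc _ _ _)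
        ?_ fun r hr => ?_
      · have := (intervalIntegrable_window hc (w (k + d)) (k + d - h) k).comp_add_right (k + d - h)
        rwa [sub_self, show k - (k + d - h) = h - d by ring] at this
      · have := hw.incr r (r + (k + d - h)) (h - r) hr.1 (by linarith) (by linarith [hr.2])
          (by linarith)
        have q1 : r + (k + d - h) + (h - r) = k + d := by ring
        have q2 : r + (h - r) = h := by ring
        rw [q1, q2] at this
        split_ifs <;> linarith
    have e4 := intervalIntegral.integral_comp_add_right (a := 0) (b := h - d)
      (fun r => if w (k + d) - w r < 1 then (1 : ℝ) else 0) (k + d - h)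
    rw [e4] at e3
    have e5 : ∫ r in (0 + (k + d - h))..(h - d + (k + d - h)), (if w (k + d) - w r < 1 then (1 : ℝ) else 0)
        ≤ window w (w (k + d)) k := by
      refine intervalIntegral.integral_mono_interval (by linarith) (by linarith) (by linarith) ?_
        (intervalIntegrable_window hc _ _ _)
      exact Eventually.of_forall fun r => hnn _ _
    simp at e2
    linarith

/-- Formally `(w + stripGain w)' = 1 + w' (1 - window)`. Both factors of the product are nonnegative
and nonincreasing, the second because `window ≤ h ≤ 1`. Since `w` need not be differentiable,
increments are compared instead, at the price of an error of second order in `d`. -/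
lemma Diminishing.add_stripGain_approx {w : ℝ → ℝ} (hw : Diminishing w) {h k d : ℝ} (hh : 0 ≤ h)
    (hk : h ≤ k) (hd : 0 ≤ d) (hkd : k + d ≤ 1) :
    (w (k + d) + stripGain w (k + d)) - (w k + stripGain w k) ≤
      (w (h + d) + stripGain w (h + d)) - (w h + stripGain w h) +
        d * ((w (h + d) - w h) + (w (k + d) - w k)) := by
  have h1 := le_stripGain_sub hw hh (by linarith : h ≤ h + d) (by linarith)
  have h2 := stripGain_sub_le hw (by linarith : 0 ≤ k) (by linarith : k ≤ k + d) hkd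
  have h3 := window_sub_le hw hh hk hd hkd
  have h4 := window_le hw.continuous (w h) hh
  have h5 := hw.incr h k d hh hk hd hkd
  have h6 := hw.mono k (k + d) (by linarith) (by linarith) hkd
  have h7 : (w (k + d) - w k) * (window w (w h) h - d) ≤
      (w (k + d) - w k) * window w (w (k + d)) k :=
    mul_le_mul_of_nonneg_left h3 (by linarith)
  have h8 : 0 ≤ ((w (h + d) - w h) - (w (k + d) - w k)) * (1 - window w (w h) h) :=
    mul_nonneg (by linarith) (by linarith)
  simp only [add_sub_cancel_left] at h1 h2
  nlinarith

/-- The second-order error disappears under subdivision: over `N + 1` steps of length `e = d / (N +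
1)` the errors telescope to `e * c`. -/
lemma increment_le_of_approx {g w : ℝ → ℝ} {h k d : ℝ} (hd : 0 ≤ d)
    (H : ∀ x e, 0 ≤ x → 0 ≤ e → x + e ≤ d → g (k + x + e) - g (k + x) ≤
      g (h + x + e) - g (h + x) +
        e * ((w (h + x + e) - w (h + x)) + (w (k + x + e) - w (k + x)))) :
    g (k + d) - g k ≤ g (h + d) - g h := by
  set c := (w (h + d) - w h) + (w (k + d) - w k) with hc
  have key : ∀ N : ℕ, g (k + d) - g k ≤ g (h + d) - g h + (d / (N + 1 : ℕ)) * c := by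
    intro N
    set e : ℝ := d / (N + 1 : ℕ) with he
    have hN : ((N + 1 : ℕ) : ℝ) ≠ 0 := by positivity
    have heN : ((N + 1 : ℕ) : ℝ) * e = d := by rw [he]; field_simp
    have he0 : 0 ≤ e := by positivity
    have tel : ∀ (f : ℝ → ℝ) (a : ℝ), ∑ i ∈ Finset.range (N + 1), (f (a + i * e + e) - f (a + i * e))
        = f (a + d) - f a := by
      intro f a
      have := Finset.sum_range_sub (fun i : ℕ => f (a + i * e)) (N + 1)
      rw [heN] at this
      simp only [Nat.cast_zero, zero_mul, add_zero] at this
      rw [← this]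
      refine Finset.sum_congr rfl fun i _ => ?_
      push_cast
      ring_nf
    have hs : ∑ i ∈ Finset.range (N + 1), (g (k + i * e + e) - g (k + i * e)) ≤
        ∑ i ∈ Finset.range (N + 1), ((g (h + i * e + e) - g (h + i * e)) + e *
          ((w (h + i * e + e) - w (h + i * e)) + (w (k + i * e + e) - w (k + i * e)))) := by
      refine Finset.sum_le_sum fun i hi => ?_
      refine H (i * e) e (by positivity) he0 ?_
      have : ((i : ℝ) + 1) ≤ ((N + 1 : ℕ) : ℝ) := by
        have := Finset.mem_range.1 hi
        exact_mod_cast this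
      nlinarith
    rw [Finset.sum_add_distrib, ← Finset.mul_sum, Finset.sum_add_distrib] at hs
    simp only [tel] at hs
    exact hs
  have lim : Tendsto (fun N : ℕ => g (h + d) - g h + (d / (N + 1 : ℕ)) * c) atTop
      (nhds (g (h + d) - g h + 0 * c)) := by
    refine tendsto_const_nhds.add (Tendsto.mul_const _ ?_)
    exact (tendsto_const_div_atTop_nhds_zero_nat d).comp (tendsto_add_atTop_nat 1)
  simpa using ge_of_tendsto' lim key

lemma continuous_stripGain {W : ℝ → ℝ → ℝ} (hW : Continuous (Function.uncurry W)) :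
    Continuous fun p : ℝ × ℝ => stripGain (W p.1) p.2 := by
  unfold stripGain
  refine intervalIntegral.continuous_parametric_intervalIntegral_of_continuous
    (f := fun (p : ℝ × ℝ) r => max (1 + W p.1 r - W p.1 p.2) 0) ?_ (by fun_prop)
  fun_prop

lemma Diminishing.add_stripGain {w : ℝ → ℝ} (hw : Diminishing w) :
    Diminishing fun h => w h + stripGain w h where
  continuous := by
    have hc := hw.continuous
    have := (continuous_stripGain (W := fun _ => w) (by fun_prop)).comp
      (Continuous.prodMk_right (0 : ℝ))
    exact hc.add this
  mono h k hh hk k1 := by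
    have h1 := le_stripGain_sub hw hh hk k1
    have h2 := window_le hw.continuous (w h) hh
    have h3 := hw.mono h k hh hk k1
    have : 0 ≤ (w k - w h) * (h - window w (w h) h) := mul_nonneg (by linarith) (by linarith)
    have : 0 ≤ (w k - w h) * (1 - k) := mul_nonneg (by linarith) (by linarith)
    nlinarith
  incr h k d hh hk hd hkd := by
    refine increment_le_of_approx (w := w) (g := fun h => w h + stripGain w h) hd
      fun x e hx he hxe => ?_
    exact hw.add_stripGain_approx (by linarith) (by linarith) he (by linarith)

/-- Picard iterates, in Duhamel form, of the optimality equation for strips. -/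
def stripValue : ℕ → ℝ → ℝ → ℝ
  | 0, _, _ => 0
  -- The equation `∂ₜ w = stripGain w` is rewritten as `∂ₜ w + w = w + stripGain w`, so that the
  -- operator being iterated is the one known to preserve `Diminishing`.
  | n + 1, t, h => ∫ s in (0 : ℝ)..t, exp (-(t - s)) *
      (stripValue n s h + stripGain (stripValue n s) h)

lemma continuous_stripValue (n : ℕ) : Continuous (Function.uncurry (stripValue n)) := by
  induction n with
  | zero => exact continuous_const
  | succ n ih =>
    have h1 := continuous_stripGain ih
    simp only [stripValue, Function.uncurry_def] at *
    refine intervalIntegral.continuous_parametric_intervalIntegral_of_continuous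
      (f := fun (p : ℝ × ℝ) s => exp (-(p.1 - s)) *
        (stripValue n s p.2 + stripGain (stripValue n s) p.2)) ?_ (by fun_prop)
    have h2 : Continuous fun q : (ℝ × ℝ) × ℝ => stripValue n q.2 q.1.2 :=
      ih.comp (g := fun p : ℝ × ℝ => stripValue n p.1 p.2)
        (f := fun q : (ℝ × ℝ) × ℝ => (q.2, q.1.2)) (by fun_prop)
    have h3 : Continuous fun q : (ℝ × ℝ) × ℝ => stripGain (stripValue n q.2) q.1.2 :=
      h1.comp (f := fun q : (ℝ × ℝ) × ℝ => (q.2, q.1.2)) (by fun_prop)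
    simp only [Function.uncurry_def]
    fun_prop

lemma continuous_stripValue_integrand (n : ℕ) (t h : ℝ) : Continuous fun s => exp (-(t - s)) *
      (stripValue n s h + stripGain (stripValue n s) h) := by
  have h2 : Continuous fun s => stripValue n s h :=
    (continuous_stripValue n).comp (f := fun s : ℝ => (s, h)) (by fun_prop)
  have h3 : Continuous fun s => stripGain (stripValue n s) h :=
    (continuous_stripGain (continuous_stripValue n)).comp (f := fun s : ℝ => (s, h)) (by fun_prop)
  fun_prop

lemma diminishing_stripValue (n : ℕ) : ∀ t, 0 ≤ t → Diminishing (stripValue n t) := by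
  induction n with
  | zero =>
    intro t _
    exact ⟨continuous_const, fun _ _ _ _ _ => le_rfl, fun _ _ _ _ _ _ _ => le_rfl⟩
  | succ n ih =>
    intro t ht
    have hi := fun h => (continuous_stripValue_integrand n t h).intervalIntegrable
      (μ := volume) 0 t
    refine ⟨(continuous_stripValue (n + 1)).comp (f := fun h : ℝ => (t, h)) (by fun_prop), ?_, ?_⟩
    · intro h k hh hk k1
      refine intervalIntegral.integral_mono_on ht (hi h) (hi k) fun s hs => ?_
      have := (ih s hs.1).add_stripGain.mono h k hh hk k1
      gcongr
    · intro h k d hh hk hd hkd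
      simp only [stripValue]
      rw [← intervalIntegral.integral_sub (hi _) (hi _), ← intervalIntegral.integral_sub (hi _) (hi _)]
      refine intervalIntegral.integral_mono_on ht ((hi _).sub (hi _)) ((hi _).sub (hi _))
        fun s hs => ?_
      have := (ih s hs.1).add_stripGain.incr h k d hh hk hd hkd
      simp only [← mul_sub]
      gcongr

/-- A rectangle matters only through its area; this identifies `t ↦ V (t h)` as a solution of the
strip equation. -/
lemma stripGain_scale (V : ℝ → ℝ) (s h : ℝ) :
    stripGain (fun r => V (s * r)) h = h * gain V (s * h) := by
  unfold stripGain gain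
  have h1 := intervalIntegral.integral_comp_sub_left (a := 0) (b := 1)
    (fun y => max (1 + V (s * h * y) - V (s * h)) 0) 1
  simp only [sub_self, sub_zero] at h1
  rw [h1]
  have h2 := intervalIntegral.mul_integral_comp_mul_left (a := 0) (b := 1) 
    (f := fun r => max (1 + V (s * r) - V (s * h)) 0) (c := h)
  simp only [mul_zero, mul_one] at h2
  rw [← h2]
  simp only [mul_assoc]

lemma value_duhamel {t h : ℝ} (ht : 0 ≤ t) (hh : 0 ≤ h) :
    value (t * h) = ∫ s in (0 : ℝ)..t, exp (-(t - s)) *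
      (value (s * h) + stripGain (fun r => value (s * r)) h) := by
  have hcv := continuous_value
  have hcg := continuous_gain_value
  simp only [stripGain_scale]
  rcases hh.eq_or_lt with rfl | hh
  · simp
  have h1 : ∫ s in (0 : ℝ)..t, exp s * (value (s * h) + h * gain value (s * h)) =
      exp t * value (t * h) - exp 0 * value (0 * h) := by
    refine intervalIntegral.integral_eq_sub_of_hasDeriv_right_of_le
      (f := fun s => exp s * value (s * h)) ht (by fun_prop) ?_
      (Continuous.intervalIntegrable (by fun_prop) _ _)
    intro s hs
    have h2 := (hasDerivAt_value (mul_pos hs.1 hh)).comp s ((hasDerivAt_id s).mul_const h)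
    have h3 := (Real.hasDerivAt_exp s).mul h2
    refine (h3.congr_deriv ?_).hasDerivWithinAt
    simp
    ring
  have h4 : ∫ s in (0 : ℝ)..t, exp (-(t - s)) * (value (s * h) + h * gain value (s * h)) =
      exp (-t) * ∫ s in (0 : ℝ)..t, exp s * (value (s * h) + h * gain value (s * h)) := by
    rw [← intervalIntegral.integral_const_mul]
    congr 1
    ext s
    rw [← mul_assoc, ← exp_add]
    congr 2
    ring
  rw [h4, h1]
  simp only [zero_mul, value_zero, mul_zero, sub_zero]
  rw [← mul_assoc, ← exp_add]
  simp

lemma abs_stripGain_sub_le {v w : ℝ → ℝ} (hv : Continuous v) (hw : Continuous w) {h C : ℝ}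
    (hh : 0 ≤ h) (h1 : h ≤ 1) (H : ∀ r, 0 ≤ r → r ≤ 1 → |v r - w r| ≤ C) :
    |stripGain v h - stripGain w h| ≤ 2 * C := by
  have hC : 0 ≤ C := (abs_nonneg _).trans (H 0 le_rfl zero_le_one)
  unfold stripGain
  rw [← intervalIntegral.integral_sub (Continuous.intervalIntegrable (by fun_prop) _ _)
    (Continuous.intervalIntegrable (by fun_prop) _ _)]
  have := intervalIntegral.norm_integral_le_of_norm_le_const (a := 0) (b := h) (C := 2 * C)
    (f := fun r => max (1 + v r - v h) 0 - max (1 + w r - w h) 0) ?_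
  · rw [Real.norm_eq_abs, sub_zero, abs_of_nonneg hh] at this
    nlinarith
  intro r hr
  rw [uIoc_of_le hh] at hr
  have e1 := H h hh h1
  have e2 := H r hr.1.le (hr.2.trans h1)
  rw [Real.norm_eq_abs]
  refine (abs_max_sub_max_le_abs _ _ _).trans ?_
  rw [abs_le] at *
  constructor <;> linarith [e1.1, e1.2, e2.1, e2.2]

/-- The map `w ↦ w + stripGain w` is `3`-Lipschitz in the supremum norm on `[0,1]`, and `∫₀ᵗ 3 exp
(-(t - s)) exp (5 s) ds ≤ exp (5 t) / 2`, so each iteration halves the weighted error. -/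
lemma abs_stripValue_sub_le (n : ℕ) : ∀ t h, 0 ≤ t → 0 ≤ h → h ≤ 1 →
    |stripValue n t h - value (t * h)| ≤ (1 / 2) ^ n * exp (5 * t) := by
  have hcv := continuous_value
  have hcg := continuous_gain_value
  induction n with
  | zero =>
    intro t h ht hh h1
    simp only [stripValue, zero_sub, abs_neg, pow_zero, one_mul]
    rw [abs_of_nonneg (value_nonneg (by positivity))]
    have := value_le (mul_nonneg ht hh)
    have := add_one_le_exp (5 * t)
    nlinarith
  | succ n ih =>
    intro t h ht hh h1
    have hi := fun h => (continuous_stripValue_integrand n t h).intervalIntegrable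
      (μ := volume) 0 t
    rw [value_duhamel ht hh, stripValue, ← intervalIntegral.integral_sub (hi h)
      (Continuous.intervalIntegrable (by simp only [stripGain_scale]; fun_prop) _ _)]
    have hb : |∫ s in (0 : ℝ)..t, (exp (-(t - s)) * (stripValue n s h + stripGain (stripValue n s) h)
        - exp (-(t - s)) * (value (s * h) + stripGain (fun r => value (s * r)) h))| ≤
        ∫ s in (0 : ℝ)..t, 3 * (1 / 2) ^ n * exp (-t) * exp (6 * s) := by
      rw [← Real.norm_eq_abs]
      refine intervalIntegral.norm_integral_le_of_norm_le ht ?_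
        (Continuous.intervalIntegrable (by fun_prop) _ _)
      refine Eventually.of_forall fun s hs => ?_
      have e1 := ih s h hs.1.le hh h1
      have e2 := abs_stripGain_sub_le (diminishing_stripValue n s hs.1.le).continuous
        (w := fun r => value (s * r)) (by fun_prop) hh h1 (fun r hr hr1 => ih s r hs.1.le hr hr1)
      rw [← mul_sub, norm_mul, Real.norm_eq_abs, Real.norm_eq_abs, abs_of_pos (exp_pos _)]
      have e3 : |stripValue n s h + stripGain (stripValue n s) h -
          (value (s * h) + stripGain (fun r => value (s * r)) h)| ≤ 3 * ((1 / 2) ^ n * exp (5 * s)) := by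
        rw [abs_le] at *
        constructor <;> linarith [e1.1, e1.2, e2.1, e2.2]
      calc _ ≤ exp (-(t - s)) * (3 * ((1 / 2) ^ n * exp (5 * s))) := by gcongr
        _ = 3 * (1 / 2) ^ n * (exp (-(t - s)) * exp (5 * s)) := by ring
        _ = 3 * (1 / 2) ^ n * (exp (-t) * exp (6 * s)) := by
          rw [← exp_add, ← exp_add]
          ring_nf
        _ = _ := by ring
    refine hb.trans ?_
    rw [intervalIntegral.integral_const_mul]
    have e4 : ∫ s in (0 : ℝ)..t, exp (6 * s) = (exp (6 * t) - 1) / 6 := by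
      simp
      ring
    have e5 : exp (-t) * exp (6 * t) = exp (5 * t) := by
      rw [← exp_add]; ring_nf
    have e6 : 3 * (1 / 2) ^ n * exp (-t) * ((exp (6 * t) - 1) / 6) =
        (1 / 2) ^ (n + 1) * (exp (-t) * exp (6 * t)) - (1 / 2) ^ (n + 1) * exp (-t) := by ring
    rw [e4, e6, e5]
    have : 0 < (1 / 2 : ℝ) ^ (n + 1) * exp (-t) := by positivity
    linarith

lemma tendsto_stripValue {t h : ℝ} (ht : 0 ≤ t) (hh : 0 ≤ h) (h1 : h ≤ 1) :
    Tendsto (fun n => stripValue n t h) atTop (nhds (value (t * h))) := by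
  rw [tendsto_iff_dist_tendsto_zero]
  refine squeeze_zero (fun _ => dist_nonneg) (fun n => ?_)
    (g := fun n => (1 / 2) ^ n * exp (5 * t)) ?_
  · rw [Real.dist_eq]
    exact abs_stripValue_sub_le n t h ht hh h1
  · simpa using (tendsto_pow_atTop_nhds_zero_of_lt_one (r := (1 / 2 : ℝ)) (by norm_num)
      (by norm_num)).mul_const (exp (5 * t))

lemma value_increment_le {x y d : ℝ} (hx : 0 ≤ x) (hxy : x ≤ y) (hd : 0 ≤ d) :
    value (y + d) - value y ≤ value (x + d) - value x := by
  -- Scaling by `T` brings all arguments to heights in `[0,1]`; the summand `1` keeps `T` positive.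
  set T := y + d + 1 with hT
  have T0 : 0 < T := by linarith
  have hle : ∀ z, z ≤ y + d → z / T ≤ 1 := fun z hz => by rw [div_le_one T0]; linarith
  have lim : ∀ z, 0 ≤ z → z ≤ y + d →
      Tendsto (fun n => stripValue n T (z / T)) atTop (nhds (value z)) := by
    intro z hz hz1
    have := tendsto_stripValue T0.le (div_nonneg hz T0.le) (hle z hz1)
    rwa [mul_div_cancel₀ _ T0.ne'] at this
  refine le_of_tendsto_of_tendsto' ((lim (y + d) (by linarith) le_rfl).sub
    (lim y (by linarith) (by linarith)))
    ((lim (x + d) (by linarith) (by linarith)).sub (lim x hx (by linarith))) fun n => ?_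
  have := (diminishing_stripValue n T T0.le).incr (x / T) (y / T) (d / T) (by positivity)
    (by gcongr) (by positivity) (by rw [← add_div]; exact hle _ le_rfl)
  simpa [add_div] using this

lemma concaveOn_value : ConcaveOn ℝ (Ici 0) value := by
  refine AntitoneOn.concaveOn_of_deriv (convex_Ici 0) continuous_value.continuousOn ?_ ?_
  · rw [interior_Ici]
    exact fun x hx => (hasDerivAt_value hx).differentiableAt.differentiableWithinAt
  · rw [interior_Ici]
    intro x hx y hy hxy
    have hs : ∀ z, 0 < z → Tendsto (fun d : ℝ => d⁻¹ • (value (z + d) - value z)) (nhdsWithin 0 (Ioi 0))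
        (nhds (deriv value z)) := fun z hz =>
      (hasDerivAt_value hz).differentiableAt.hasDerivAt.tendsto_slope_zero_right
    refine le_of_tendsto_of_tendsto (hs y hy) (hs x hx) ?_
    filter_upwards [self_mem_nhdsWithin] with d hd
    have hd' : 0 < d := hd
    have := value_increment_le (le_of_lt hx) hxy hd'.le
    simp only [smul_eq_mul]
    gcongr

/-! ### Independence and compensation for one item -/

/-- The law of a single item: its time gap and its mark. -/
def itemLaw (ν : ℝ) : Measure (ℝ × I) := (expMeasure ν).prod (volume : Measure I)

lemma isProbabilityMeasure_itemLaw {ν : ℝ} (hν : 0 < ν) : IsProbabilityMeasure (itemLaw ν) := by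
  have := isProbabilityMeasure_expMeasure hν
  unfold itemLaw
  infer_instance

lemma isProbabilityMeasure_sampleLaw {ν : ℝ} (hν : 0 < ν) :
    IsProbabilityMeasure (sampleLaw ν) := by
  have := isProbabilityMeasure_itemLaw hν
  exact (inferInstance : IsProbabilityMeasure (Measure.infinitePi fun _ : ℕ => itemLaw ν))

/-- An item is independent of everything determined by the previous items. -/
lemma lintegral_past_item {ν : ℝ} (hν : 0 < ν) {α : Type*} [MeasurableSpace α] (n : ℕ)
    {f : Sample → α} (hf : Measurable f)
    (hdep : ∀ ω ω' : Sample, (∀ k < n, ω k = ω' k) → f ω = f ω')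
    {H : α × (ℝ × I) → ℝ≥0∞} (hH : Measurable H) :
    ∫⁻ ω, H (f ω, ω n) ∂sampleLaw ν = ∫⁻ ω, ∫⁻ e, H (f ω, e) ∂itemLaw ν ∂sampleLaw ν := by
  have hp := isProbabilityMeasure_itemLaw hν
  have hp' := isProbabilityMeasure_sampleLaw hν
  have hμ : sampleLaw ν = Measure.infinitePi fun _ : ℕ => itemLaw ν := rfl
  have hi : iIndepFun (fun (i : ℕ) (ω : Sample) => ω i) (sampleLaw ν) := by
    rw [hμ]
    exact iIndepFun_infinitePi (P := fun _ : ℕ => itemLaw ν) (X := fun _ x => x)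
      (fun _ => measurable_id)
  have hfin := hi.indepFun_finset (Finset.range n) {n} (by simp) (fun i => measurable_pi_apply i)
  -- A function of the first `n` items factors through their coordinates; the remaining ones are
  -- padded with an arbitrary value.
  set extend : ((i : Finset.range n) → ℝ × I) → Sample :=
    fun r i => if h : i ∈ Finset.range n then r ⟨i, h⟩ else (0, 0) with hext
  have hextend : Measurable extend := by
    refine measurable_pi_lambda _ fun i => ?_
    by_cases h : i ∈ Finset.range n
    · simp only [hext, h, dite_true]
      exact measurable_pi_apply _
    · simp only [hext, h, dite_false]
      exact measurable_const
  have hind : IndepFun f (fun ω : Sample => ω n) (sampleLaw ν) := by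
    have hlast : Measurable fun r : ((i : ({n} : Finset ℕ)) → ℝ × I) =>
        r ⟨n, Finset.mem_singleton_self n⟩ := measurable_pi_apply _
    have := hfin.comp (φ := fun r => f (extend r))
      (ψ := fun r : ((i : ({n} : Finset ℕ)) → ℝ × I) => r ⟨n, Finset.mem_singleton_self n⟩)
      (hf.comp hextend) hlast
    refine this.congr (Eventually.of_forall fun ω => ?_) (Eventually.of_forall fun ω => rfl)
    refine hdep _ _ fun k hk => ?_
    simp [hext, hk]
  have hmap := (indepFun_iff_map_prod_eq_prod_map_map hf.aemeasurable
    (measurable_pi_apply n).aemeasurable).1 hind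
  have heval : (sampleLaw ν).map (fun ω : Sample => ω n) = itemLaw ν :=
    Measure.infinitePi_map_eval (fun _ : ℕ => itemLaw ν) n
  have hpair : Measurable fun ω : Sample => (f ω, ω n) := hf.prodMk (measurable_pi_apply n)
  rw [heval] at hmap
  rw [← lintegral_map (f := H) hH hpair, hmap, lintegral_prod _ hH.aemeasurable,
    lintegral_map hH.lintegral_prod_right' hf]

lemma expMeasure_Iic_zero {ν : ℝ} (hν : 0 < ν) : expMeasure ν (Iic 0) = 0 := by
  have := isProbabilityMeasure_expMeasure hν
  rw [← ofReal_cdf, cdf_expMeasure_eq hν]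
  simp

lemma expMeasure_Ioi {ν : ℝ} (hν : 0 < ν) {u : ℝ} (hu : 0 ≤ u) :
    expMeasure ν (Ioi u) = ENNReal.ofReal (exp (-(ν * u))) := by
  have := isProbabilityMeasure_expMeasure hν
  rw [← compl_Iic, prob_compl_eq_one_sub measurableSet_Iic, ← ofReal_cdf, cdf_expMeasure_eq hν,
    if_pos hu, ← ENNReal.ofReal_one, ← ENNReal.ofReal_sub _ ?_]
  · congr 1; ring
  · have : exp (-(ν * u)) ≤ 1 := exp_le_one_iff.2 (by have := mul_nonneg hν.le hu; linarith)
    linarith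

/-- The compensator of an exponential time grows at constant rate until that time. -/
lemma lintegral_expMeasure_eq {ν : ℝ} (hν : 0 < ν) {k : ℝ → ℝ≥0∞} (hk : Measurable k) :
    ∫⁻ g, k g ∂expMeasure ν =
      ∫⁻ g, (∫⁻ u in Ioo 0 g, ENNReal.ofReal ν * k u) ∂expMeasure ν := by
  have := isProbabilityMeasure_expMeasure hν
  have hset : MeasurableSet {p : ℝ × ℝ | 0 < p.2 ∧ p.2 < p.1} :=
    (measurableSet_lt measurable_const measurable_snd).inter
      (measurableSet_lt measurable_snd measurable_fst)
  have e1 : ∫⁻ g, (∫⁻ u in Ioo 0 g, ENNReal.ofReal ν * k u) ∂expMeasure ν =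
      ∫⁻ g, (∫⁻ u, {p : ℝ × ℝ | 0 < p.2 ∧ p.2 < p.1}.indicator
        (fun p => ENNReal.ofReal ν * k p.2) (g, u)) ∂expMeasure ν := by
    refine lintegral_congr fun g => ?_
    rw [← lintegral_indicator measurableSet_Ioo]
    rfl
  have hmeas : Measurable ({p : ℝ × ℝ | 0 < p.2 ∧ p.2 < p.1}.indicator
      (fun p => ENNReal.ofReal ν * k p.2)) := Measurable.indicator (by fun_prop) hset
  rw [e1, lintegral_lintegral_swap (f := fun g u => {p : ℝ × ℝ | 0 < p.2 ∧ p.2 < p.1}.indicator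
    (fun p => ENNReal.ofReal ν * k p.2) (g, u)) hmeas.aemeasurable]
  -- After Fubini the inner integral is the tail `exp (-(ν u))`, and `ν` times the tail is the
  -- exponential density.
  have e2 : ∀ u : ℝ, ∫⁻ g, {p : ℝ × ℝ | 0 < p.2 ∧ p.2 < p.1}.indicator
        (fun p => ENNReal.ofReal ν * k p.2) (g, u) ∂expMeasure ν =
      (Ioi 0).indicator (fun u => ENNReal.ofReal ν * k u * ENNReal.ofReal (exp (-(ν * u)))) u := by
    intro u
    by_cases hu : 0 < u
    · rw [indicator_of_mem (mem_Ioi.2 hu), ← expMeasure_Ioi hν hu.le,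
        ← lintegral_indicator_const measurableSet_Ioi]
      refine lintegral_congr fun g => ?_
      simp [indicator, hu]
    · simp [indicator, hu]
  simp only [e2]
  rw [expMeasure, gammaMeasure, lintegral_withDensity_eq_lintegral_mul _
    (show Measurable (gammaPDF 1 ν) from (measurable_gammaPDFReal 1 ν).ennreal_ofReal) hk]
  refine lintegral_congr_ae ?_
  have : ∀ᵐ u : ℝ, u ≠ 0 := Measure.ae_ne volume 0
  filter_upwards [this] with u hu
  rcases lt_or_gt_of_ne hu with h | h
  · rw [indicator_of_notMem (by simpa using h.le), Pi.mul_apply, gammaPDF_of_neg h, zero_mul]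
  · rw [indicator_of_mem (mem_Ioi.2 h), Pi.mul_apply,
      show gammaPDF 1 ν u = ENNReal.ofReal (ν * exp (-(ν * u))) from exponentialPDF_of_nonneg h.le,
      ENNReal.ofReal_mul hν.le]
    ring

/-- The time at which the period of waiting for item `n` begins. -/
def start (ω : Sample) (n : ℕ) : ℝ := ∑ k ∈ Finset.range n, (ω k).1

/-- The last selected mark before item `n`. -/
def level (ψ : ℝ → ℝ → ℝ) (ω : Sample) (n : ℕ) : ℝ := (chain ψ ω n).1

lemma start_succ (ω : Sample) (n : ℕ) : start ω (n + 1) = start ω n + (ω n).1 :=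
  Finset.sum_range_succ _ _

lemma arrival_eq_start (ω : Sample) (n : ℕ) : arrival ω n = start ω (n + 1) := rfl

@[fun_prop] lemma measurable_start (n : ℕ) : Measurable fun ω => start ω n := by
  unfold start
  fun_prop

lemma start_congr {ω ω' : Sample} {n : ℕ} (h : ∀ k < n, ω k = ω' k) : start ω n = start ω' n :=
  Finset.sum_congr rfl fun k hk => by rw [h k (Finset.mem_range.1 hk)]

lemma chain_congr (ψ : ℝ → ℝ → ℝ) {ω ω' : Sample} {n : ℕ} (h : ∀ k < n, ω k = ω' k) :
    chain ψ ω n = chain ψ ω' n := by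
  induction n with
  | zero => rfl
  | succ n ih =>
    have h1 := ih fun k hk => h k (hk.trans n.lt_succ_self)
    have h2 : mark ω n = mark ω' n := by rw [mark, mark, h n n.lt_succ_self]
    have h3 : arrival ω n = arrival ω' n := start_congr h
    simp only [chain, h1, h2, h3]

lemma measurable_chain {ψ : ℝ → ℝ → ℝ} (hψ : Measurable (Function.uncurry ψ)) (n : ℕ) :
    Measurable fun ω => chain ψ ω n := by
  induction n with
  | zero => exact measurable_const
  | succ n ih =>
    have hm : Measurable fun ω => mark ω n := by unfold mark; fun_prop
    have ha : Measurable fun ω => arrival ω n := measurable_start (n + 1)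
    have hp : Measurable fun ω => ψ (arrival ω n) (chain ψ ω n).1 :=
      hψ.comp (ha.prodMk ih.fst)
    simp only [chain]
    refine Measurable.ite ?_ (hm.prodMk (by fun_prop)) ih
    exact (measurableSet_lt ih.fst hm).inter (measurableSet_le hm (ih.fst.add hp))

lemma measurable_level {ψ : ℝ → ℝ → ℝ} (hψ : Measurable (Function.uncurry ψ)) (n : ℕ) :
    Measurable fun ω => level ψ ω n := (measurable_chain hψ n).fst

lemma level_mem (ψ : ℝ → ℝ → ℝ) (ω : Sample) (n : ℕ) : level ψ ω n ∈ Icc (0 : ℝ) 1 := by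
  induction n with
  | zero => simp [level, chain]
  | succ n ih =>
    simp only [level, chain] at *
    split_ifs
    · exact (ω n).2.2
    · exact ih

/-- Given the past, the gap is exponential and the mark is independent of it and uniform. Freezing
the past on both sides with `lintegral_past_item` leaves the compensator identity for the gap alone.
-/
lemma lintegral_item_eq {ν : ℝ} (hν : 0 < ν) {ψ : ℝ → ℝ → ℝ}
    (hψ : Measurable (Function.uncurry ψ)) {h : ℝ → ℝ → I → ℝ≥0∞}
    (hh : Measurable fun p : ℝ × ℝ × I => h p.1 p.2.1 p.2.2) (n : ℕ) :
    ∫⁻ ω, h (start ω (n + 1)) (level ψ ω n) (ω n).2 ∂sampleLaw ν =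
      ∫⁻ ω, (∫⁻ s in Ioo (start ω n) (start ω (n + 1)),
        ENNReal.ofReal ν * ∫⁻ y, h s (level ψ ω n) y) ∂sampleLaw ν := by
  have := isProbabilityMeasure_expMeasure hν
  set f : Sample → ℝ × ℝ := fun ω => (start ω n, level ψ ω n) with hf
  have hfm : Measurable f := (measurable_start n).prodMk (measurable_level hψ n)
  have hdep : ∀ ω ω' : Sample, (∀ k < n, ω k = ω' k) → f ω = f ω' := fun ω ω' hk => by
    simp only [hf, level, start_congr hk, chain_congr ψ hk]
  have hK : Measurable fun p : ℝ × ℝ => ∫⁻ y, h p.1 p.2 y :=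
    Measurable.lintegral_prod_right' (f := fun p : (ℝ × ℝ) × I => h p.1.1 p.1.2 p.2)
      (hh.comp (by fun_prop : Measurable fun p : (ℝ × ℝ) × I => (p.1.1, p.1.2, p.2)))
  have e1 := lintegral_past_item hν n hfm hdep
    (H := fun p => h (p.1.1 + p.2.1) p.1.2 p.2.2)
    (hh.comp (by fun_prop : Measurable fun p : (ℝ × ℝ) × ℝ × I => (p.1.1 + p.2.1, p.1.2, p.2.2)))
  have hset : MeasurableSet {p : ((ℝ × ℝ) × ℝ × I) × ℝ | 0 < p.2 ∧ p.2 < p.1.2.1} :=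
    (measurableSet_lt measurable_const measurable_snd).inter
      (measurableSet_lt measurable_snd measurable_fst.snd.fst)
  have hL : Measurable fun p : (ℝ × ℝ) × ℝ × I =>
      ∫⁻ u in Ioo 0 p.2.1, ENNReal.ofReal ν * ∫⁻ y, h (p.1.1 + u) p.1.2 y := by
    have : Measurable fun q : ((ℝ × ℝ) × ℝ × I) × ℝ =>
        {p : ((ℝ × ℝ) × ℝ × I) × ℝ | 0 < p.2 ∧ p.2 < p.1.2.1}.indicator
          (fun p => ENNReal.ofReal ν * ∫⁻ y, h (p.1.1.1 + p.2) p.1.1.2 y) q := by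
      refine Measurable.indicator (Measurable.const_mul ?_ _) hset
      exact hK.comp (by fun_prop : Measurable fun p : ((ℝ × ℝ) × ℝ × I) × ℝ =>
        (p.1.1.1 + p.2, p.1.1.2))
    convert this.lintegral_prod_right' (ν := volume) using 2 with p
    rw [← lintegral_indicator measurableSet_Ioo]
    rfl
  have e2 := lintegral_past_item hν n hfm hdep hL
  simp only [hf, ← start_succ] at e1 e2
  rw [e1]
  have e3 : ∀ ω, ∫⁻ s in Ioo (start ω n) (start ω (n + 1)),
        ENNReal.ofReal ν * ∫⁻ y, h s (level ψ ω n) y =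
      ∫⁻ u in Ioo 0 (ω n).1, ENNReal.ofReal ν * ∫⁻ y, h (start ω n + u) (level ψ ω n) y := by
    intro ω
    rw [← lintegral_indicator measurableSet_Ioo, ← lintegral_indicator measurableSet_Ioo,
      ← lintegral_add_left_eq_self _ (start ω n)]
    refine lintegral_congr fun u => ?_
    simp [indicator, start_succ]
  simp only [e3]
  rw [e2]
  refine lintegral_congr fun ω => ?_
  have hm1 : Measurable fun e : ℝ × I => h (start ω n + e.1) (level ψ ω n) e.2 :=
    hh.comp (by fun_prop : Measurable fun e : ℝ × I => (start ω n + e.1, level ψ ω n, e.2))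
  have hm2 : Measurable fun e : ℝ × I =>
      ∫⁻ u in Ioo 0 e.1, ENNReal.ofReal ν * ∫⁻ y, h (start ω n + u) (level ψ ω n) y :=
    hL.comp (by fun_prop : Measurable fun e : ℝ × I => ((start ω n, level ψ ω n), e))
  unfold itemLaw
  rw [lintegral_prod _ hm1.aemeasurable, lintegral_prod _ hm2.aemeasurable,
    lintegral_expMeasure_eq hν hm1.lintegral_prod_right']
  simp

/-! ### Regular samples and compensation along the whole path -/

/-- Samples whose observation times increase strictly to infinity. -/
structure Regular (ω : Sample) : Prop where
  strictMono : StrictMono (start ω)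
  tendsto : Tendsto (start ω) atTop atTop

@[simp] lemma start_zero (ω : Sample) : start ω 0 = 0 := by simp [start]

lemma ae_gap_pos {ν : ℝ} (hν : 0 < ν) : ∀ᵐ ω ∂sampleLaw ν, ∀ n, 0 < (ω n).1 := by
  have := isProbabilityMeasure_expMeasure hν
  have := isProbabilityMeasure_itemLaw hν
  rw [ae_all_iff]
  intro n
  have h1 : ∀ᵐ e ∂itemLaw ν, 0 < e.1 := by
    have h0 : ∀ᵐ g ∂expMeasure ν, 0 < g := by
      have := expMeasure_Iic_zero hν
      rw [ae_iff]
      convert this using 2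
      ext x
      simp
    exact Measure.quasiMeasurePreserving_fst.ae h0
  have heval : (sampleLaw ν).map (fun ω : Sample => ω n) = itemLaw ν :=
    Measure.infinitePi_map_eval (fun _ : ℕ => itemLaw ν) n
  rw [← heval] at h1
  exact ae_of_ae_map (measurable_pi_apply n).aemeasurable h1

/-- With `r = E exp (-gap) < 1`, independence gives `E exp (-start n) = r ^ n`, which is summable;
hence `exp (-start n)` tends to `0` almost surely. -/
lemma ae_tendsto_start {ν : ℝ} (hν : 0 < ν) :
    ∀ᵐ ω ∂sampleLaw ν, Tendsto (start ω) atTop atTop := by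
  have := isProbabilityMeasure_expMeasure hν
  have := isProbabilityMeasure_itemLaw hν
  have := isProbabilityMeasure_sampleLaw hν
  set r := ∫⁻ g, ENNReal.ofReal (exp (-g)) ∂expMeasure ν with hr
  have hpos : ∀ᵐ g ∂expMeasure ν, 0 < g := by
    have := expMeasure_Iic_zero hν
    rw [ae_iff]
    convert this using 2
    ext x
    simp
  have hr1 : r < 1 := by
    have h1 : ∫⁻ _, 1 ∂expMeasure ν = 1 := by simp
    have hlt : ∀ᵐ g ∂expMeasure ν, ENNReal.ofReal (exp (-g)) < 1 := by
      filter_upwards [hpos] with g hg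
      rw [← ENNReal.ofReal_one]
      exact (ENNReal.ofReal_lt_ofReal_iff one_pos).2 (by simpa using hg)
    rw [← h1]
    refine lintegral_strict_mono (IsProbabilityMeasure.ne_zero _) (by fun_prop) ?_ hlt
    refine ((lintegral_mono_ae (hlt.mono fun _ h => h.le)).trans_lt ?_).ne
    simp
  have hpow : ∀ n, ∫⁻ ω, ENNReal.ofReal (exp (-start ω n)) ∂sampleLaw ν = r ^ n := by
    intro n
    induction n with
    | zero => simp
    | succ n ih =>
      have h1 := lintegral_past_item hν n (measurable_start n) (fun ω ω' h => start_congr h)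
        (H := fun p => ENNReal.ofReal (exp (-p.1)) * ENNReal.ofReal (exp (-p.2.1))) (by fun_prop)
      have h2 : ∀ ω, ENNReal.ofReal (exp (-start ω (n + 1))) =
          ENNReal.ofReal (exp (-start ω n)) * ENNReal.ofReal (exp (-(ω n).1)) := by
        intro ω
        rw [← ENNReal.ofReal_mul (exp_pos _).le, ← exp_add, start_succ]
        ring_nf
      simp only [h2]
      rw [h1, pow_succ, ← ih]
      have h3 : ∀ c : ℝ≥0∞, ∫⁻ e : ℝ × I, c * ENNReal.ofReal (exp (-e.1)) ∂itemLaw ν = c * r := by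
        intro c
        unfold itemLaw
        rw [lintegral_const_mul _ (by fun_prop),
          lintegral_prod _ (Measurable.aemeasurable (by fun_prop))]
        simp [hr]
      simp only [h3]
      rw [lintegral_mul_const _ (by fun_prop)]
  have hsum : ∫⁻ ω, ∑' n, ENNReal.ofReal (exp (-start ω n)) ∂sampleLaw ν ≠ ∞ := by
    rw [lintegral_tsum (fun n => Measurable.aemeasurable (by fun_prop))]
    simp only [hpow]
    rw [ENNReal.tsum_geometric]
    exact ENNReal.inv_ne_top.2 (tsub_pos_of_lt hr1).ne'
  filter_upwards [ae_lt_top (by fun_prop) hsum] with ω hω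
  have h1 := ENNReal.tendsto_atTop_zero_of_tsum_ne_top hω.ne
  have h2 : Tendsto (fun n => exp (-start ω n)) atTop (nhds 0) := by
    have := (ENNReal.tendsto_toReal ENNReal.zero_ne_top).comp h1
    simpa [Function.comp_def, ENNReal.toReal_ofReal (exp_pos _).le] using this
  rw [Real.tendsto_exp_comp_nhds_zero] at h2
  exact tendsto_neg_atBot_iff.1 h2

lemma ae_regular {ν : ℝ} (hν : 0 < ν) : ∀ᵐ ω ∂sampleLaw ν, Regular ω := by
  filter_upwards [ae_gap_pos hν, ae_tendsto_start hν] with ω h1 h2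
  exact ⟨strictMono_nat_of_lt_succ fun n => by rw [start_succ]; linarith [h1 n], h2⟩

/-- Item `m` arrives at `start (m + 1)`, so exactly the items `m < n` have arrived. Regularity also
excludes an infinite set of arrivals, whose `ncard` would be the default value `0`. -/
lemma Regular.arrivalCount_eq {ω : Sample} (hω : Regular ω) {n : ℕ} {s : ℝ}
    (hs : s ∈ Ico (start ω n) (start ω (n + 1))) : arrivalCount ω s = n := by
  have : {m : ℕ | arrival ω m ≤ s} = Finset.range n := by
    ext m
    simp only [mem_ofPred_eq, arrival_eq_start, Finset.coe_range, mem_Iio]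
    constructor
    · intro h
      by_contra hc
      have := hω.strictMono.monotone (by omega : n + 1 ≤ m + 1)
      linarith [hs.2]
    · intro h
      have := hω.strictMono.monotone (by omega : m + 1 ≤ n)
      linarith [hs.1]
  rw [arrivalCount, this, ncard_coe_finset, Finset.card_range]

lemma Regular.exists_mem_Ico {ω : Sample} (hω : Regular ω) {s : ℝ} (hs : 0 ≤ s) :
    ∃ n, s ∈ Ico (start ω n) (start ω (n + 1)) := by
  classical
  obtain ⟨m, hm⟩ := (hω.tendsto.eventually_gt_atTop s).exists
  have hex : ∃ m, s < start ω m := ⟨m, hm⟩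
  have h1 := Nat.find_spec hex
  have h0 : Nat.find hex ≠ 0 := fun h => by
    rw [h, start_zero] at h1
    linarith
  obtain ⟨n, hn⟩ := Nat.exists_eq_succ_of_ne_zero h0
  refine ⟨n, ?_, by rwa [hn] at h1⟩
  exact not_lt.1 (Nat.find_min hex (by omega))

lemma Regular.arrivalCount_mem {ω : Sample} (hω : Regular ω) {s : ℝ} (hs : 0 ≤ s) :
    s ∈ Ico (start ω (arrivalCount ω s)) (start ω (arrivalCount ω s + 1)) := by
  obtain ⟨n, hn⟩ := hω.exists_mem_Ico hs
  rwa [hω.arrivalCount_eq hn]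

lemma Regular.start_succ_le_iff {ω : Sample} (hω : Regular ω) {s : ℝ} (hs : 0 ≤ s) {n : ℕ} :
    start ω (n + 1) ≤ s ↔ n < arrivalCount ω s := by
  have h := hω.arrivalCount_mem hs
  constructor
  · intro h1
    have := hω.strictMono.lt_iff_lt.1 (h1.trans_lt h.2)
    omega
  · intro h1
    exact (hω.strictMono.monotone (by omega : n + 1 ≤ arrivalCount ω s)).trans h.1

/-- The waiting periods tile the half-line, and during the period of item `n` the count is `n`. This
turns sums over items into integrals over time. -/
lemma Regular.tsum_setLIntegral {ω : Sample} (hω : Regular ω) (φ : ℕ → ℝ → ℝ≥0∞) :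
    ∑' n, ∫⁻ s in Ioo (start ω n) (start ω (n + 1)), φ n s =
      ∫⁻ s in Ioi 0, φ (arrivalCount ω s) s := by
  have hU : ⋃ n, Ico (start ω n) (start ω (n + 1)) = Ici 0 := by
    ext s
    simp only [mem_iUnion, mem_Ici]
    constructor
    · rintro ⟨n, hn⟩
      have := hω.strictMono.monotone (Nat.zero_le n)
      rw [start_zero] at this
      exact this.trans hn.1
    · exact fun hs => hω.exists_mem_Ico hs
  have hd : Pairwise (Function.onFun Disjoint fun n => Ico (start ω n) (start ω (n + 1))) :=
    hω.strictMono.monotone.pairwise_disjoint_on_Ico_succ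
  rw [setLIntegral_congr (Ioi_ae_eq_Ici (a := (0 : ℝ))), ← hU,
    lintegral_iUnion (fun _ => measurableSet_Ico) hd]
  refine tsum_congr fun n => ?_
  rw [setLIntegral_congr Ioo_ae_eq_Ico]
  refine setLIntegral_congr_fun measurableSet_Ico fun s hs => ?_
  simp only [hω.arrivalCount_eq hs]

lemma runningMax_eq_level (ψ : ℝ → ℝ → ℝ) (t : ℝ) (ω : Sample) :
    runningMax ψ t ω = level ψ ω (arrivalCount ω t) := rfl

lemma runningMax_mem (ψ : ℝ → ℝ → ℝ) (t : ℝ) (ω : Sample) :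
    runningMax ψ t ω ∈ Icc (0 : ℝ) 1 := level_mem ψ ω _

lemma measurable_arrivalCount : Measurable fun p : ℝ × Sample => arrivalCount p.2 p.1 := by
  refine measurable_ncard.comp (measurable_set_iff.2 fun n => ?_)
  exact measurableSet_setOfPred.1 (measurableSet_le (f := fun p : ℝ × Sample => arrival p.2 n)
    ((measurable_start (n + 1)).comp measurable_snd) measurable_fst)

lemma measurable_runningMax {ψ : ℝ → ℝ → ℝ} (hψ : Measurable (Function.uncurry ψ)) :
    Measurable fun p : ℝ × Sample => runningMax ψ p.1 p.2 := by
  have h : Measurable fun q : Sample × ℕ => level ψ q.1 q.2 :=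
    measurable_from_prod_countable_left fun n => measurable_level hψ n
  exact h.comp (measurable_snd.prodMk measurable_arrivalCount)

lemma measurable_lengthProcess {ψ : ℝ → ℝ → ℝ} (hψ : Measurable (Function.uncurry ψ)) (t : ℝ) :
    Measurable (lengthProcess ψ t) := by
  have h : Measurable fun q : Sample × ℕ => (chain ψ q.1 q.2).2 :=
    measurable_from_prod_countable_left fun n => (measurable_chain hψ n).snd
  exact h.comp (measurable_id.prodMk
    (measurable_arrivalCount.comp (measurable_const.prodMk measurable_id)))

/-- The compensation formula for sums over the observed items. -/
lemma lintegral_tsum_item_eq {ν : ℝ} (hν : 0 < ν) {ψ : ℝ → ℝ → ℝ}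
    (hψ : Measurable (Function.uncurry ψ)) {h : ℝ → ℝ → I → ℝ≥0∞}
    (hh : Measurable fun p : ℝ × ℝ × I => h p.1 p.2.1 p.2.2) :
    ∫⁻ ω, ∑' n, h (start ω (n + 1)) (level ψ ω n) (ω n).2 ∂sampleLaw ν =
      ∫⁻ s in Ioi 0, ∫⁻ ω, ENNReal.ofReal ν * ∫⁻ y, h s (runningMax ψ s ω) y ∂volume
        ∂sampleLaw ν := by
  have := isProbabilityMeasure_sampleLaw hν
  have hK : Measurable fun p : ℝ × ℝ => ∫⁻ y, h p.1 p.2 y :=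
    Measurable.lintegral_prod_right' (f := fun p : (ℝ × ℝ) × I => h p.1.1 p.1.2 p.2)
      (hh.comp (by fun_prop : Measurable fun p : (ℝ × ℝ) × I => (p.1.1, p.1.2, p.2)))
  have hKX : Measurable fun p : ℝ × Sample =>
      ENNReal.ofReal ν * ∫⁻ y, h p.1 (runningMax ψ p.1 p.2) y :=
    (hK.comp (measurable_fst.prodMk (measurable_runningMax hψ))).const_mul _
  have hterm : ∀ n, Measurable fun ω : Sample => h (start ω (n + 1)) (level ψ ω n) (ω n).2 :=
    fun n => hh.comp ((measurable_start (n + 1)).prodMk ((measurable_level hψ n).prodMk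
      (by fun_prop)))
  rw [lintegral_tsum fun n => (hterm n).aemeasurable]
  simp only [lintegral_item_eq hν hψ hh]
  rw [lintegral_lintegral_swap hKX.aemeasurable, ← lintegral_tsum]
  · refine lintegral_congr_ae ?_
    filter_upwards [ae_regular hν] with ω hω
    rw [hω.tsum_setLIntegral fun n s => ENNReal.ofReal ν * ∫⁻ y, h s (level ψ ω n) y]
    rfl
  · intro n
    have hset : MeasurableSet {p : Sample × ℝ | start p.1 n < p.2 ∧ p.2 < start p.1 (n + 1)} :=
      (measurableSet_lt (by fun_prop) measurable_snd).inter
        (measurableSet_lt measurable_snd (by fun_prop))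
    have hm : Measurable ({p : Sample × ℝ | start p.1 n < p.2 ∧ p.2 < start p.1 (n + 1)}.indicator
        fun p => ENNReal.ofReal ν * ∫⁻ y, h p.2 (level ψ p.1 n) y) :=
      Measurable.indicator ((hK.comp (measurable_snd.prodMk
        ((measurable_level hψ n).comp measurable_fst))).const_mul _) hset
    refine Measurable.aemeasurable ?_
    convert hm.lintegral_prod_right' (ν := volume) using 2 with ω
    rw [← lintegral_indicator measurableSet_Ioo]
    rfl

/-! ### Functionals of the selected items and the drift of the mean -/

/-- Under the control `ψ`, an item with mark `y` observed at time `s` is selected when the last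
selected mark is `x`. -/
def Selects (ψ : ℝ → ℝ → ℝ) (s x y : ℝ) : Prop := x < y ∧ y ≤ x + ψ s x

open Classical in
/-- The contribution of an item to a functional of the selected items observed before `t`. -/
def reward (ψ : ℝ → ℝ → ℝ) (F : ℝ → ℝ → ℝ → ℝ) (t s x y : ℝ) : ℝ≥0∞ :=
  if s ≤ t ∧ Selects ψ s x y then ENNReal.ofReal (F s x y) else 0

lemma measurable_reward {ψ : ℝ → ℝ → ℝ} (hψ : Measurable (Function.uncurry ψ))
    {F : ℝ → ℝ → ℝ → ℝ} (hF : Measurable fun p : ℝ × ℝ × ℝ => F p.1 p.2.1 p.2.2) (t : ℝ) :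
    Measurable fun p : ℝ × ℝ × ℝ => reward ψ F t p.1 p.2.1 p.2.2 := by
  have h1 : Measurable fun p : ℝ × ℝ × ℝ => ψ p.1 p.2.1 :=
    hψ.comp (by fun_prop : Measurable fun p : ℝ × ℝ × ℝ => (p.1, p.2.1))
  unfold reward Selects
  refine Measurable.ite ?_ hF.ennreal_ofReal measurable_const
  exact (measurableSet_le measurable_fst measurable_const).inter
    ((measurableSet_lt measurable_snd.fst measurable_snd.snd).inter
      (measurableSet_le measurable_snd.snd (measurable_snd.fst.add h1)))

/-- Feasibility keeps the acceptance interval inside `[0,1]`, where the law of a mark is Lebesgue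
measure. -/
lemma lintegral_reward {ψ : ℝ → ℝ → ℝ} (hψ : Feasible ψ) {F : ℝ → ℝ → ℝ → ℝ} {t s x : ℝ}
    (hs : s ∈ Ioc 0 t) (ht : t ≤ 1) (hx : x ∈ Icc (0 : ℝ) 1) (hF : Continuous (F s x))
    (hF0 : ∀ r ∈ Icc x 1, 0 ≤ F s x r) :
    ∫⁻ y : I, reward ψ F t s x y = ENNReal.ofReal (∫ r in x..(x + ψ s x), F s x r) := by
  have hs1 : s ∈ Icc (0 : ℝ) 1 := ⟨hs.1.le, hs.2.trans ht⟩
  have h0 := hψ.nonneg s hs1 x hx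
  have h1 := hψ.le s hs1 x hx
  have e1 : ∫⁻ y : I, reward ψ F t s x y = ∫⁻ y in Icc (0 : ℝ) 1, reward ψ F t s x y :=
    lintegral_subtype_comap measurableSet_Icc _
  have e2 : ∀ y ∈ Icc (0 : ℝ) 1, reward ψ F t s x y =
      (Ioc x (x + ψ s x)).indicator (fun r => ENNReal.ofReal (F s x r)) y := by
    intro y _
    simp [reward, Selects, hs.2, indicator]
  rw [e1, setLIntegral_congr_fun measurableSet_Icc e2, setLIntegral_indicator measurableSet_Ioc,
    inter_eq_self_of_subset_left (show Ioc x (x + ψ s x) ⊆ Icc 0 1 from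
      fun r hr => ⟨hx.1.trans hr.1.le, by linarith [hr.2]⟩),
    intervalIntegral.integral_of_le (by linarith), ofReal_integral_eq_lintegral_ofReal]
  · exact (hF.intervalIntegrable _ _).1
  · refine (ae_restrict_mem measurableSet_Ioc).mono fun r hr => hF0 r ⟨hr.1.le, ?_⟩
    linarith [hr.2]

lemma lintegral_tsum_reward {ν : ℝ} (hν : 0 < ν) {ψ : ℝ → ℝ → ℝ} (hψ : Feasible ψ)
    {F : ℝ → ℝ → ℝ → ℝ} (hF : Continuous fun p : ℝ × ℝ × ℝ => F p.1 p.2.1 p.2.2)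
    (hF0 : ∀ s ∈ Icc (0 : ℝ) 1, ∀ x ∈ Icc (0 : ℝ) 1, ∀ r ∈ Icc x 1, 0 ≤ F s x r) {t : ℝ}
    (ht : t ≤ 1) :
    ∫⁻ ω, ∑' n, reward ψ F t (start ω (n + 1)) (level ψ ω n) (mark ω n) ∂sampleLaw ν =
      ∫⁻ s in Ioc 0 t, ∫⁻ ω, ENNReal.ofReal (ν * ∫ r in (runningMax ψ s ω)..
        (runningMax ψ s ω + ψ s (runningMax ψ s ω)), F s (runningMax ψ s ω) r) ∂sampleLaw ν := by
  have hm := measurable_reward hψ.measurable hF.measurable t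
  have h1 := lintegral_tsum_item_eq hν hψ.measurable (h := fun s x y => reward ψ F t s x y)
    (hm.comp (by fun_prop : Measurable fun p : ℝ × ℝ × I => (p.1, p.2.1, (p.2.2 : ℝ))))
  refine h1.trans ?_
  rw [← lintegral_indicator measurableSet_Ioi, ← lintegral_indicator measurableSet_Ioc]
  refine lintegral_congr fun s => ?_
  by_cases hs : s ∈ Ioc 0 t
  · rw [indicator_of_mem hs, indicator_of_mem (mem_Ioi.2 hs.1)]
    refine lintegral_congr fun ω => ?_
    have hs1 : s ∈ Icc (0 : ℝ) 1 := ⟨hs.1.le, hs.2.trans ht⟩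
    have hx := runningMax_mem ψ s ω
    rw [lintegral_reward hψ hs ht hx (by fun_prop) (hF0 s hs1 _ hx), ENNReal.ofReal_mul hν.le]
  · rw [indicator_of_notMem hs]
    by_cases hs0 : 0 < s
    · have hts : ¬ s ≤ t := fun h => hs ⟨hs0, h⟩
      rw [indicator_of_mem (mem_Ioi.2 hs0)]
      simp [reward, hts]
    · rw [indicator_of_notMem (by simpa using hs0)]

open Classical in
lemma chain_succ (ψ : ℝ → ℝ → ℝ) (ω : Sample) (n : ℕ) : chain ψ ω (n + 1) =
    if Selects ψ (start ω (n + 1)) (level ψ ω n) (mark ω n) then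
      (mark ω n, (chain ψ ω n).2 + 1) else chain ψ ω n := by
  simp only [chain, Selects, level, arrival_eq_start]
  congr

/-- Telescoping: items observed by time `t` contribute the increments of `A`, later items nothing.
-/
lemma Regular.tsum_reward {ω : Sample} (hω : Regular ω) {ψ : ℝ → ℝ → ℝ}
    {F : ℝ → ℝ → ℝ → ℝ} {t : ℝ} (ht : 0 ≤ t) (A : ℕ → ℝ) 
    (hA : ∀ n < arrivalCount ω t, ENNReal.ofReal (A (n + 1) - A n) =
      reward ψ F t (start ω (n + 1)) (level ψ ω n) (mark ω n))
    (hmono : ∀ n < arrivalCount ω t, A n ≤ A (n + 1)) :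
    ∑' n, reward ψ F t (start ω (n + 1)) (level ψ ω n) (mark ω n) =
      ENNReal.ofReal (A (arrivalCount ω t) - A 0) := by
  rw [tsum_eq_sum (s := Finset.range (arrivalCount ω t)), ← Finset.sum_range_sub,
    ENNReal.ofReal_sum_of_nonneg]
  · exact Finset.sum_congr rfl fun n hn => (hA n (Finset.mem_range.1 hn)).symm
  · exact fun n hn => sub_nonneg.2 (hmono n (Finset.mem_range.1 hn))
  · intro n hn
    rw [Finset.mem_range, ← hω.start_succ_le_iff ht] at hn
    simp [reward, hn]

lemma Regular.ofReal_runningMax {ω : Sample} (hω : Regular ω) (ψ : ℝ → ℝ → ℝ) {t : ℝ}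
    (ht : 0 ≤ t) : ENNReal.ofReal (runningMax ψ t ω) =
      ∑' n, reward ψ (fun _ x y => y - x) t (start ω (n + 1)) (level ψ ω n) (mark ω n) := by
  rw [hω.tsum_reward ht (level ψ ω)]
  · simp [runningMax_eq_level, level, chain]
  · intro n hn
    have := (hω.start_succ_le_iff ht).2 hn
    rw [reward, level.eq_def ψ ω (n + 1), chain_succ]
    by_cases h : Selects ψ (start ω (n + 1)) (level ψ ω n) (mark ω n)
    · simp [this, h]
    · rw [if_neg h, if_neg fun hc => h hc.2]
      simp [level]
  · intro n hn
    rw [level, level, chain_succ]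
    split_ifs with h
    · exact h.1.le
    · exact le_rfl

lemma Regular.ofReal_lengthProcess {ω : Sample} (hω : Regular ω) (ψ : ℝ → ℝ → ℝ) {t : ℝ}
    (ht : 0 ≤ t) : ENNReal.ofReal (lengthProcess ψ t ω) =
      ∑' n, reward ψ (fun _ _ _ => 1) t (start ω (n + 1)) (level ψ ω n) (mark ω n) := by
  rw [hω.tsum_reward ht (fun n => (chain ψ ω n).2)]
  · simp [lengthProcess, chain]
  · intro n hn
    have := (hω.start_succ_le_iff ht).2 hn
    rw [reward, chain_succ]
    by_cases h : Selects ψ (start ω (n + 1)) (level ψ ω n) (mark ω n)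
    · simp [this, h]
    · simp [h]
  · intro n hn
    rw [chain_succ]
    split_ifs with h <;> simp

/-- The increment `y - x` integrates to `ψ² / 2` over the acceptance window, whence the quadratic
drift. -/
lemma lintegral_runningMax {ν : ℝ} (hν : 0 < ν) {ψ : ℝ → ℝ → ℝ} (hψ : Feasible ψ) {t : ℝ}
    (ht : t ∈ Icc (0 : ℝ) 1) :
    ∫⁻ ω, ENNReal.ofReal (runningMax ψ t ω) ∂sampleLaw ν =
      ∫⁻ s in Ioc 0 t, ∫⁻ ω, ENNReal.ofReal (ν * ψ s (runningMax ψ s ω) ^ 2 / 2) ∂sampleLaw ν := by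
  have h1 : ∫⁻ ω, ENNReal.ofReal (runningMax ψ t ω) ∂sampleLaw ν = _ :=
    lintegral_congr_ae ((ae_regular hν).mono fun ω hω => hω.ofReal_runningMax ψ ht.1)
  rw [h1, lintegral_tsum_reward hν hψ (by fun_prop)
    (fun s _ x _ r hr => sub_nonneg.2 hr.1) ht.2]
  refine lintegral_congr fun s => lintegral_congr fun ω => ?_
  congr 1
  rw [intervalIntegral.integral_sub (by simp) (by simp), integral_id,
    intervalIntegral.integral_const, smul_eq_mul]
  ring

lemma lintegral_lengthProcess {ν : ℝ} (hν : 0 < ν) {ψ : ℝ → ℝ → ℝ} (hψ : Feasible ψ) {t : ℝ}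
    (ht : t ∈ Icc (0 : ℝ) 1) :
    ∫⁻ ω, ENNReal.ofReal (lengthProcess ψ t ω) ∂sampleLaw ν =
      ∫⁻ s in Ioc 0 t, ∫⁻ ω, ENNReal.ofReal (ν * ψ s (runningMax ψ s ω)) ∂sampleLaw ν := by
  have h1 : ∫⁻ ω, ENNReal.ofReal (lengthProcess ψ t ω) ∂sampleLaw ν = _ :=
    lintegral_congr_ae ((ae_regular hν).mono fun ω hω => hω.ofReal_lengthProcess ψ ht.1)
  rw [h1, lintegral_tsum_reward hν hψ (by fun_prop) (fun s _ x _ r hr => zero_le_one) ht.2]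
  simp

/-- The derivative of the mean running maximum. -/
def drift (ψ : ℝ → ℝ → ℝ) (ν s : ℝ) : ℝ :=
  ∫ ω, ν * ψ s (runningMax ψ s ω) ^ 2 / 2 ∂sampleLaw ν

lemma measurable_control_runningMax {ψ : ℝ → ℝ → ℝ} (hψ : Feasible ψ) :
    Measurable fun p : ℝ × Sample => ψ p.1 (runningMax ψ p.1 p.2) :=
  hψ.measurable.comp (measurable_fst.prodMk (measurable_runningMax hψ.measurable))

lemma control_mem {ψ : ℝ → ℝ → ℝ} (hψ : Feasible ψ) {s : ℝ} (hs : s ∈ Icc (0 : ℝ) 1)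
    (ω : Sample) : ψ s (runningMax ψ s ω) ∈ Icc (0 : ℝ) 1 := by
  have hx := runningMax_mem ψ s ω
  exact ⟨hψ.nonneg s hs _ hx, (hψ.le s hs _ hx).trans (by linarith [hx.1])⟩

lemma measurable_control_section {ψ : ℝ → ℝ → ℝ} (hψ : Feasible ψ) (s : ℝ) :
    Measurable fun ω : Sample => ψ s (runningMax ψ s ω) :=
  (measurable_control_runningMax hψ).comp (measurable_const.prodMk measurable_id)

lemma integrable_of_mem_Icc {α : Type*} [MeasurableSpace α] {μ : Measure α} [IsFiniteMeasure μ]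
    {f : α → ℝ} (hf : Measurable f) {a b : ℝ} (h : ∀ x, f x ∈ Icc a b) : Integrable f μ :=
  Integrable.of_mem_Icc a b hf.aemeasurable (Eventually.of_forall h)

lemma integrable_drift {ν : ℝ} (hν : 0 < ν) {ψ : ℝ → ℝ → ℝ} (hψ : Feasible ψ) {s : ℝ}
    (hs : s ∈ Icc (0 : ℝ) 1) :
    Integrable (fun ω => ν * ψ s (runningMax ψ s ω) ^ 2 / 2) (sampleLaw ν) := by
  have := isProbabilityMeasure_sampleLaw hν
  have hm := measurable_control_section hψ s
  refine integrable_of_mem_Icc (a := 0) (b := ν)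
    (((hm.pow_const 2).const_mul ν).div_const 2) fun ω => ?_
  have h := control_mem hψ hs ω
  have h2 : ψ s (runningMax ψ s ω) ^ 2 ≤ 1 := pow_le_one₀ h.1 h.2
  constructor
  · positivity
  · nlinarith

lemma drift_mem {ν : ℝ} (hν : 0 < ν) {ψ : ℝ → ℝ → ℝ} (hψ : Feasible ψ) {s : ℝ}
    (hs : s ∈ Icc (0 : ℝ) 1) : drift ψ ν s ∈ Icc 0 ν := by
  have := isProbabilityMeasure_sampleLaw hν
  constructor
  · exact integral_nonneg fun ω => by positivity
  · have h1 : drift ψ ν s ≤ ∫ _ω, ν ∂sampleLaw ν := by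
      refine integral_mono (integrable_drift hν hψ hs) (integrable_const _) fun ω => ?_
      have h := control_mem hψ hs ω
      have h2 : ψ s (runningMax ψ s ω) ^ 2 ≤ 1 := pow_le_one₀ h.1 h.2
      dsimp only
      nlinarith
    simpa using h1

lemma measurable_drift {ν : ℝ} (hν : 0 < ν) {ψ : ℝ → ℝ → ℝ} (hψ : Feasible ψ) :
    Measurable (drift ψ ν) := by
  have := isProbabilityMeasure_sampleLaw hν
  have hm := measurable_control_runningMax hψ
  have : StronglyMeasurable fun p : ℝ × Sample => ν * ψ p.1 (runningMax ψ p.1 p.2) ^ 2 / 2 :=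
    (((hm.pow_const 2).const_mul ν).div_const 2).stronglyMeasurable
  exact (this.integral_prod_right' (ν := sampleLaw ν)).measurable

lemma intervalIntegrable_drift {ν : ℝ} (hν : 0 < ν) {ψ : ℝ → ℝ → ℝ} (hψ : Feasible ψ) {a b : ℝ}
    (ha : a ∈ Icc (0 : ℝ) 1) (hb : b ∈ Icc (0 : ℝ) 1) :
    IntervalIntegrable (drift ψ ν) volume a b := by
  refine (intervalIntegrable_const (c := ν)).mono_fun (measurable_drift hν hψ).aestronglyMeasurable ?_
  refine (ae_restrict_mem measurableSet_uIoc).mono fun s hs => ?_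
  have h := drift_mem hν hψ (s := s) (uIcc_subset_Icc ha hb (uIoc_subset_uIcc hs))
  dsimp only
  rw [Real.norm_eq_abs, Real.norm_eq_abs, abs_of_nonneg h.1, abs_of_pos hν]
  exact h.2

lemma meanMax_eq {ν : ℝ} (hν : 0 < ν) {ψ : ℝ → ℝ → ℝ} (hψ : Feasible ψ) {t : ℝ}
    (ht : t ∈ Icc (0 : ℝ) 1) : meanMax ψ ν t = ∫ s in (0 : ℝ)..t, drift ψ ν s := by
  have hm : Measurable fun ω => runningMax ψ t ω :=
    (measurable_runningMax hψ.measurable).comp (measurable_const.prodMk measurable_id)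
  rw [meanMax, integral_eq_lintegral_of_nonneg_ae
    (Eventually.of_forall fun ω => (runningMax_mem ψ t ω).1) hm.aestronglyMeasurable,
    lintegral_runningMax hν hψ ht, intervalIntegral.integral_of_le ht.1,
    integral_eq_lintegral_of_nonneg_ae
      ((ae_restrict_mem measurableSet_Ioc).mono fun s hs =>
        (drift_mem hν hψ ⟨hs.1.le, hs.2.trans ht.2⟩).1)
      (measurable_drift hν hψ).aestronglyMeasurable]
  congr 1
  refine setLIntegral_congr_fun measurableSet_Ioc fun s hs => ?_
  have hs1 : s ∈ Icc (0 : ℝ) 1 := ⟨hs.1.le, hs.2.trans ht.2⟩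
  rw [drift, ofReal_integral_eq_lintegral_ofReal (integrable_drift hν hψ hs1)]
  exact Eventually.of_forall fun ω => by have := hν.le; dsimp; positivity

lemma ofReal_meanLength {ν : ℝ} (hν : 0 < ν) {ψ : ℝ → ℝ → ℝ} (hψ : Feasible ψ) :
    ENNReal.ofReal (meanLength ψ ν 1) =
      ∫⁻ s in Ioc 0 1, ∫⁻ ω, ENNReal.ofReal (ν * ψ s (runningMax ψ s ω)) ∂sampleLaw ν := by
  have := isProbabilityMeasure_sampleLaw hν
  have h1 := lintegral_lengthProcess hν hψ (t := 1) (by simp)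
  have hfin : ∫⁻ s in Ioc 0 1, ∫⁻ ω, ENNReal.ofReal (ν * ψ s (runningMax ψ s ω)) ∂sampleLaw ν ≠ ∞ := by
    refine ((setLIntegral_mono (g := fun _ => ENNReal.ofReal ν) (by fun_prop) fun s hs => ?_).trans_lt
      ?_).ne
    · refine (lintegral_mono (g := fun _ => ENNReal.ofReal ν) fun ω => ?_).trans (by simp)
      have := control_mem hψ (s := s) ⟨hs.1.le, hs.2⟩ ω
      exact ENNReal.ofReal_le_ofReal (by nlinarith [this.2])
    · simp
  have hm : Measurable fun ω => (lengthProcess ψ 1 ω : ℝ) :=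
    measurable_from_top.comp (measurable_lengthProcess hψ.measurable 1)
  rw [meanLength, integral_eq_lintegral_of_nonneg_ae (Eventually.of_forall fun ω => by positivity)
    hm.aestronglyMeasurable, h1, ENNReal.ofReal_toReal hfin]

/-! ### Verification of the value and the shape of optimal controls -/

/-- The value of the game at time `s` when the last selected mark is `x`. -/
def reserve (ν s x : ℝ) : ℝ := value (ν * (1 - s) * (1 - x))

/-- The rate of decrease of the value with time. -/
def decay (ν s x : ℝ) : ℝ := ν * (1 - x) * gain value (ν * (1 - s) * (1 - x))

lemma continuous_reserve (ν : ℝ) : Continuous fun p : ℝ × ℝ => reserve ν p.1 p.2 := by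
  have := continuous_value
  unfold reserve
  fun_prop

@[fun_prop] lemma continuous_reserve_right (ν s : ℝ) : Continuous (reserve ν s) :=
  (continuous_reserve ν).comp (Continuous.prodMk_right s)

lemma continuous_decay (ν : ℝ) : Continuous fun p : ℝ × ℝ => decay ν p.1 p.2 := by
  have := continuous_gain_value
  unfold decay
  fun_prop

lemma decay_nonneg {ν s x : ℝ} (hν : 0 < ν) (hx : x ≤ 1) : 0 ≤ decay ν s x :=
  mul_nonneg (mul_nonneg hν.le (by linarith)) (gain_nonneg _ _)

lemma reserve_anti {ν s x y : ℝ} (hν : 0 < ν) (hs : s ≤ 1) (hxy : x ≤ y) (hy : y ≤ 1) :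
    reserve ν s y ≤ reserve ν s x := by
  have h1 : 0 ≤ ν * (1 - s) := mul_nonneg hν.le (by linarith)
  exact value_mono (mul_nonneg h1 (by linarith)) (by gcongr)

@[simp] lemma reserve_one (ν x : ℝ) : reserve ν 1 x = 0 := by simp [reserve]

lemma reserve_sub {ν a b x : ℝ} (hν : 0 < ν) (hab : a ≤ b) (hb : b ≤ 1) (hx : x ≤ 1) :
    reserve ν a x - reserve ν b x = ∫ s in a..b, decay ν s x := by
  have hc : 0 ≤ ν * (1 - x) := mul_nonneg hν.le (by linarith)
  have e : ∀ s, ν * (1 - s) * (1 - x) = ν * (1 - x) - ν * (1 - x) * s := fun s => by ring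
  unfold reserve decay
  rw [intervalIntegral.integral_const_mul]
  simp only [e]
  rw [intervalIntegral.mul_integral_comp_sub_mul, value_eq (by nlinarith), value_eq (by nlinarith),
    intervalIntegral.integral_interval_sub_left (continuous_gain_value.intervalIntegrable _ _)
    (continuous_gain_value.intervalIntegrable _ _)]

lemma lintegral_decay {ν a b x : ℝ} (hν : 0 < ν) (hab : a ≤ b) (hb : b ≤ 1) (hx : x ≤ 1) :
    ∫⁻ s in Ioc a b, ENNReal.ofReal (decay ν s x) = ENNReal.ofReal (reserve ν a x - reserve ν b x) := by
  have hc : Continuous fun s => decay ν s x :=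
    (continuous_decay ν).comp (Continuous.prodMk_left x)
  rw [reserve_sub hν hab hb hx, intervalIntegral.integral_of_le hab,
    ofReal_integral_eq_lintegral_ofReal (hc.intervalIntegrable _ _).1]
  exact Eventually.of_forall fun s => decay_nonneg hν hx

/-- The reserve starts at `value ν` and vanishes at time `1`. Its decrease splits into decay while
waiting and jumps at selections. -/
lemma Regular.ofReal_value {ω : Sample} (hω : Regular ω) {ν : ℝ} (hν : 0 < ν) (ψ : ℝ → ℝ → ℝ) :
    ENNReal.ofReal (value ν) =
      (∫⁻ s in Ioc 0 1, ENNReal.ofReal (decay ν s (runningMax ψ s ω))) +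
        ∑' n, reward ψ (fun s x y => reserve ν s x - reserve ν s y) 1
          (start ω (n + 1)) (level ψ ω n) (mark ω n) := by
  set N := arrivalCount ω 1 with hN
  -- Times are capped at `1`; item `N` is the first one after time `1`, so `τ` is constant from
  -- index `N + 1` on and `N + 1` terms suffice.
  set τ : ℕ → ℝ := fun n => min (start ω n) 1 with hτ
  have hτmono : ∀ n, τ n ≤ τ (n + 1) := fun n =>
    min_le_min_right _ (hω.strictMono.monotone n.le_succ)
  have hlev := fun n => level_mem ψ ω n
  have hle : ∀ n, level ψ ω n ≤ level ψ ω (n + 1) := by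
    intro n
    rw [level, level, chain_succ]
    split_ifs with h
    · exact h.1.le
    · exact le_rfl
  have hlate : ∀ n, N < n → τ n = 1 := by
    intro n hn
    obtain ⟨m, rfl⟩ : ∃ m, n = m + 1 := ⟨n - 1, by omega⟩
    have : ¬ start ω (m + 1) ≤ 1 := fun h => by
      have := (hω.start_succ_le_iff zero_le_one).1 h
      omega
    exact min_eq_right (by linarith)
  have hwait : ∫⁻ s in Ioc 0 1, ENNReal.ofReal (decay ν s (runningMax ψ s ω)) =
      ∑ n ∈ Finset.range (N + 1), ENNReal.ofReal
        (reserve ν (τ n) (level ψ ω n) - reserve ν (τ (n + 1)) (level ψ ω n)) := by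
    have e1 := hω.tsum_setLIntegral fun n s =>
      (Iic 1).indicator (fun s => ENNReal.ofReal (decay ν s (level ψ ω n))) s
    have e2 : ∫⁻ s in Ioi 0, (Iic 1).indicator (fun s' => ENNReal.ofReal
        (decay ν s' (level ψ ω (arrivalCount ω s)))) s =
        ∫⁻ s in Ioc 0 1, ENNReal.ofReal (decay ν s (runningMax ψ s ω)) := by
      rw [← lintegral_indicator measurableSet_Ioi, ← lintegral_indicator measurableSet_Ioc]
      refine lintegral_congr fun s => ?_
      by_cases h0 : 0 < s <;> by_cases h1 : s ≤ 1 <;> simp [indicator, h0, h1, runningMax_eq_level]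
    rw [← e2, ← e1]
    have e3 : ∀ n, ∫⁻ s in Ioo (start ω n) (start ω (n + 1)),
        (Iic 1).indicator (fun s => ENNReal.ofReal (decay ν s (level ψ ω n))) s =
        ENNReal.ofReal (reserve ν (τ n) (level ψ ω n) - reserve ν (τ (n + 1)) (level ψ ω n)) := by
      intro n
      rw [← lintegral_decay hν (hτmono n) (min_le_right _ _) (hlev n).2,
        setLIntegral_congr Ioo_ae_eq_Ioc, setLIntegral_indicator measurableSet_Iic]
      congr 2
      ext s
      simp only [hτ, mem_inter_iff, mem_Iic, mem_Ioc, min_lt_iff, le_min_iff]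
      constructor
      · rintro ⟨h1, h2, h3⟩
        exact ⟨Or.inl h2, h3, h1⟩
      · rintro ⟨h1, h2, h3⟩
        exact ⟨h3, h1.resolve_right (by linarith), h2⟩
    rw [tsum_congr e3, tsum_eq_sum (s := Finset.range (N + 1))]
    intro n hn
    rw [Finset.mem_range, not_lt] at hn
    rw [hlate n (by omega), hlate (n + 1) (by omega)]
    simp
  have hjump : ∑' n, reward ψ (fun s x y => reserve ν s x - reserve ν s y) 1
      (start ω (n + 1)) (level ψ ω n) (mark ω n) =
      ∑ n ∈ Finset.range (N + 1), ENNReal.ofReal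
        (reserve ν (τ (n + 1)) (level ψ ω n) - reserve ν (τ (n + 1)) (level ψ ω (n + 1))) := by
    rw [tsum_eq_sum (s := Finset.range (N + 1))]
    · refine Finset.sum_congr rfl fun n _ => ?_
      by_cases h1 : start ω (n + 1) ≤ 1
      · rw [show τ (n + 1) = start ω (n + 1) from min_eq_left h1, level.eq_def ψ ω (n + 1),
          chain_succ, reward]
        by_cases h : Selects ψ (start ω (n + 1)) (level ψ ω n) (mark ω n)
        · simp [h1, h]
        · rw [if_neg h, if_neg fun hc => h hc.2]
          simp [level]
      · rw [show τ (n + 1) = 1 from min_eq_right (by linarith)]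
        simp [reward, h1]
    · intro n hn
      rw [Finset.mem_range, not_lt] at hn
      have : ¬ start ω (n + 1) ≤ 1 := fun h => by
        have := (hω.start_succ_le_iff zero_le_one).1 h
        omega
      simp [reward, this]
  have hnn1 : ∀ n, 0 ≤ reserve ν (τ n) (level ψ ω n) - reserve ν (τ (n + 1)) (level ψ ω n) := by
    intro n
    rw [reserve_sub hν (hτmono n) (min_le_right _ _) (hlev n).2]
    exact intervalIntegral.integral_nonneg (hτmono n) fun s _ => decay_nonneg hν (hlev n).2
  have hnn2 : ∀ n, 0 ≤ reserve ν (τ (n + 1)) (level ψ ω n) -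
      reserve ν (τ (n + 1)) (level ψ ω (n + 1)) := fun n =>
    sub_nonneg.2 (reserve_anti hν (min_le_right _ _) (hle n) (hlev (n + 1)).2)
  rw [hwait, hjump, ← Finset.sum_add_distrib]
  simp only [← ENNReal.ofReal_add (hnn1 _) (hnn2 _)]
  rw [← ENNReal.ofReal_sum_of_nonneg fun n _ => add_nonneg (hnn1 n) (hnn2 n)]
  have tel := Finset.sum_range_sub' (fun n => reserve ν (τ n) (level ψ ω n)) (N + 1)
  simp only [sub_add_sub_cancel]
  rw [tel, hlate (N + 1) (by omega)]
  simp [hτ, reserve, level, chain]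

lemma measurable_decay_runningMax {ψ : ℝ → ℝ → ℝ} (hψ : Feasible ψ) (ν : ℝ) :
    Measurable fun p : ℝ × Sample => ENNReal.ofReal (decay ν p.1 (runningMax ψ p.1 p.2)) :=
  ((continuous_decay ν).measurable.comp
    (measurable_fst.prodMk (measurable_runningMax hψ.measurable))).ennreal_ofReal

lemma continuous_reserve_sub (ν : ℝ) :
    Continuous fun p : ℝ × ℝ × ℝ => reserve ν p.1 p.2.1 - reserve ν p.1 p.2.2 :=
  ((continuous_reserve ν).comp (by fun_prop : Continuous fun p : ℝ × ℝ × ℝ => (p.1, p.2.1))).sub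
    ((continuous_reserve ν).comp (by fun_prop : Continuous fun p : ℝ × ℝ × ℝ => (p.1, p.2.2)))

/-- The expected decrease of the value caused by selecting at time `s` from level `x`. -/
def jumpRate (ν : ℝ) (ψ : ℝ → ℝ → ℝ) (s x : ℝ) : ℝ :=
  ν * ∫ r in x..(x + ψ s x), (reserve ν s x - reserve ν s r)

/-- The left side does not depend on `ψ`, so controls can be compared through their pointwise rates
alone. -/
lemma ofReal_value {ν : ℝ} (hν : 0 < ν) {ψ : ℝ → ℝ → ℝ} (hψ : Feasible ψ) :
    ENNReal.ofReal (value ν) = ∫⁻ s in Ioc 0 1, ∫⁻ ω,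
      (ENNReal.ofReal (decay ν s (runningMax ψ s ω)) +
        ENNReal.ofReal (jumpRate ν ψ s (runningMax ψ s ω))) ∂sampleLaw ν := by
  have := isProbabilityMeasure_sampleLaw hν
  have hdm := measurable_decay_runningMax hψ ν
  have hdm' : Measurable fun p : Sample × ℝ =>
      ENNReal.ofReal (decay ν p.2 (runningMax ψ p.2 p.1)) := by
    simpa only [Function.comp_def, Prod.fst_swap, Prod.snd_swap] using hdm.comp measurable_swap
  have hdi : Measurable fun ω : Sample =>
      ∫⁻ s in Ioc 0 1, ENNReal.ofReal (decay ν s (runningMax ψ s ω)) := hdm'.lintegral_prod_right'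
  have hdj : Measurable fun s : ℝ =>
      ∫⁻ ω, ENNReal.ofReal (decay ν s (runningMax ψ s ω)) ∂sampleLaw ν := hdm.lintegral_prod_right'
  have hJ := lintegral_tsum_reward hν hψ (continuous_reserve_sub ν)
    (fun s hs x _ r hr => sub_nonneg.2 (reserve_anti hν hs.2 hr.1 hr.2)) le_rfl
  calc ENNReal.ofReal (value ν) = ∫⁻ _, ENNReal.ofReal (value ν) ∂sampleLaw ν := by simp
    _ = ∫⁻ ω, ((∫⁻ s in Ioc 0 1, ENNReal.ofReal (decay ν s (runningMax ψ s ω))) +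
        ∑' n, reward ψ (fun s x y => reserve ν s x - reserve ν s y) 1
          (start ω (n + 1)) (level ψ ω n) (mark ω n)) ∂sampleLaw ν :=
      lintegral_congr_ae ((ae_regular hν).mono fun ω hω => hω.ofReal_value hν ψ)
    _ = (∫⁻ ω, (∫⁻ s in Ioc 0 1, ENNReal.ofReal (decay ν s (runningMax ψ s ω))) ∂sampleLaw ν) +
        ∫⁻ s in Ioc 0 1, ∫⁻ ω, ENNReal.ofReal (jumpRate ν ψ s (runningMax ψ s ω)) ∂sampleLaw ν := by
      rw [lintegral_add_left hdi, hJ]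
      rfl
    _ = (∫⁻ s in Ioc 0 1, ∫⁻ ω, ENNReal.ofReal (decay ν s (runningMax ψ s ω)) ∂sampleLaw ν) +
        ∫⁻ s in Ioc 0 1, ∫⁻ ω, ENNReal.ofReal (jumpRate ν ψ s (runningMax ψ s ω)) ∂sampleLaw ν := by
      rw [lintegral_lintegral_swap hdm'.aemeasurable]
    _ = _ := by
      rw [← lintegral_add_left hdj]
      refine lintegral_congr fun s => ?_
      rw [lintegral_add_left]
      simpa only [Function.comp_def] using hdm.comp (measurable_prodMk_left (x := s))

/-- The gain from selecting the mark `r` at time `s` when the last selected mark is `x`. -/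
def surplus (ν s x r : ℝ) : ℝ := 1 - (reserve ν s x - reserve ν s r)

@[fun_prop] lemma continuous_surplus (ν s x : ℝ) : Continuous (surplus ν s x) := by
  unfold surplus
  fun_prop

lemma surplus_anti {ν s x r r' : ℝ} (hν : 0 < ν) (hs : s ≤ 1) (h : r ≤ r') (hr : r' ≤ 1) :
    surplus ν s x r' ≤ surplus ν s x r := by
  have := reserve_anti hν hs h hr
  unfold surplus
  linarith

/-- The optimality equation in the variable `r = x + (1 - x) y`: the value decays at the largest
rate at which surplus can be collected. -/
lemma decay_eq (ν s x : ℝ) : decay ν s x = ν * ∫ r in x..1, max (surplus ν s x r) 0 := by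
  have h := intervalIntegral.mul_integral_comp_add_mul (a := 0) (b := 1)
    (f := fun r => max (surplus ν s x r) 0) (c := 1 - x) (d := x)
  simp only [mul_zero, add_zero, mul_one, add_sub_cancel] at h
  rw [← h, decay, gain, mul_assoc]
  congr 3
  ext y
  unfold surplus reserve
  ring_nf

lemma rate_eq (ν : ℝ) (ψ : ℝ → ℝ → ℝ) (s x : ℝ) :
    ν * ψ s x = jumpRate ν ψ s x + ν * ∫ r in x..(x + ψ s x), surplus ν s x r := by
  unfold jumpRate surplus
  rw [intervalIntegral.integral_sub (f := fun _ => (1 : ℝ)) (by simp)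
    (Continuous.intervalIntegrable (by fun_prop) _ _), intervalIntegral.integral_const]
  simp
  ring

lemma integral_surplus_le {ν s x c : ℝ} (hc : x ≤ c) (hc1 : c ≤ 1) :
    ∫ r in x..c, surplus ν s x r ≤ ∫ r in x..c, max (surplus ν s x r) 0 ∧
    ∫ r in x..c, max (surplus ν s x r) 0 ≤ ∫ r in x..1, max (surplus ν s x r) 0 := by
  constructor
  · exact intervalIntegral.integral_mono_on hc (Continuous.intervalIntegrable (by fun_prop) _ _)
      (Continuous.intervalIntegrable (by fun_prop) _ _) fun r _ => le_max_left _ _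
  · exact intervalIntegral.integral_mono_interval le_rfl hc hc1
      (Eventually.of_forall fun r => le_max_right _ _)
      (Continuous.intervalIntegrable (by fun_prop) _ _)

lemma jumpRate_nonneg {ν : ℝ} (hν : 0 < ν) {ψ : ℝ → ℝ → ℝ} {s x : ℝ} (hs : s ≤ 1)
    (h0 : 0 ≤ ψ s x) (h1 : ψ s x ≤ 1 - x) : 0 ≤ jumpRate ν ψ s x :=
  mul_nonneg hν.le (intervalIntegral.integral_nonneg (by linarith) fun _ hr =>
    sub_nonneg.2 (reserve_anti hν hs hr.1 (by linarith [hr.2])))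

/-- No window collects more surplus than the integral of its positive part. -/
lemma rate_le {ν : ℝ} (hν : 0 < ν) {ψ : ℝ → ℝ → ℝ} {s x : ℝ} (h0 : 0 ≤ ψ s x)
    (h1 : ψ s x ≤ 1 - x) : ν * ψ s x ≤ decay ν s x + jumpRate ν ψ s x := by
  have h := integral_surplus_le (ν := ν) (s := s) (x := x) (c := x + ψ s x) (by linarith)
    (by linarith)
  rw [rate_eq, decay_eq, add_comm]
  gcongr
  exact h.1.trans h.2

lemma surplus_concave {ν s x : ℝ} (hν : 0 < ν) (hs : s ≤ 1) :
    ConcaveOn ℝ (Iic 1) (surplus ν s x) := by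
  refine ⟨convex_Iic 1, fun a ha b hb p q hp hq hpq => ?_⟩
  have hc : 0 ≤ ν * (1 - s) := mul_nonneg hν.le (by linarith)
  have h := concaveOn_value.2 (x := ν * (1 - s) * (1 - a)) (y := ν * (1 - s) * (1 - b))
    (mul_nonneg hc (sub_nonneg.2 ha)) (mul_nonneg hc (sub_nonneg.2 hb)) hp hq hpq
  simp only [smul_eq_mul] at *
  have e : p * (ν * (1 - s) * (1 - a)) + q * (ν * (1 - s) * (1 - b)) =
      ν * (1 - s) * (1 - (p * a + q * b)) := by
    linear_combination ν * (1 - s) * hpq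
  rw [e] at h
  unfold surplus reserve
  linear_combination h + (1 - value (ν * (1 - s) * (1 - x))) * hpq

/-- A control that attains the maximal gain rate at `(s, x)` is below the critical curve. -/
lemma sq_le_of_rate_eq {ν : ℝ} (hν : 0 < ν) {ψ : ℝ → ℝ → ℝ} {s x : ℝ} (hs : s < 1)
    (h0 : 0 ≤ ψ s x) (h1 : ψ s x ≤ 1 - x)
    (heq : decay ν s x + jumpRate ν ψ s x = ν * ψ s x) :
    ν * (1 - s) * ψ s x ^ 2 ≤ 2 * (1 - x) := by
  set θ := ψ s x with hθ
  rcases h0.eq_or_lt with h0 | h0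
  · rw [← h0]
    linarith
  have hxc : x < x + θ := by linarith
  have hc1 : x + θ ≤ 1 := by linarith
  have hle := integral_surplus_le (ν := ν) (s := s) hxc.le hc1
  have hI : ∫ r in x..1, max (surplus ν s x r) 0 = ∫ r in x..(x + θ), surplus ν s x r := by
    have := rate_eq ν ψ s x
    rw [decay_eq] at heq
    rw [← hθ] at this
    refine mul_left_cancel₀ hν.ne' ?_
    linarith
  -- A negative surplus at the right end would, by continuity, make the window strictly worse than
  -- the positive part.
  have hend : 0 ≤ surplus ν s x (x + θ) := by
    by_contra hneg
    have hpos : 0 < ∫ r in x..(x + θ), (max (surplus ν s x r) 0 - surplus ν s x r) := by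
      refine intervalIntegral.integral_pos hxc (by fun_prop)
        (fun r _ => sub_nonneg.2 (le_max_left _ _)) ⟨x + θ, ⟨hxc.le, le_rfl⟩, ?_⟩
      have := le_max_right (surplus ν s x (x + θ)) 0
      linarith
    rw [intervalIntegral.integral_sub (Continuous.intervalIntegrable (by fun_prop) _ _)
      (Continuous.intervalIntegrable (by fun_prop) _ _)] at hpos
    linarith [hle.2]
  have hstart : surplus ν s x x = 1 := by simp [surplus]
  have hconc := surplus_concave (x := x) hν hs.le
  -- First use of concavity: on the window the surplus lies above the chord from `1` down to `0`, so
  -- its integral is at least `θ / 2`.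
  have hlow : ∀ r ∈ Icc x (x + θ), 1 - (r - x) / θ ≤ surplus ν s x r := by
    intro r hr
    have hq : 0 ≤ (r - x) / θ := div_nonneg (by linarith [hr.1]) h0.le
    have hp : 0 ≤ 1 - (r - x) / θ := by
      rw [sub_nonneg, div_le_one h0]
      linarith [hr.2]
    have := hconc.2 (x := x) (y := x + θ) (by simp; linarith) (by simpa using hc1) hp hq (by ring)
    simp only [smul_eq_mul, hstart] at this
    have e : (1 - (r - x) / θ) * x + (r - x) / θ * (x + θ) = r := by field_simp; ring
    rw [e] at this
    nlinarith [mul_nonneg hq hend]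
  have hhalf : θ / 2 ≤ ∫ r in x..(x + θ), surplus ν s x r := by
    have e : ∫ r in x..(x + θ), (1 - (r - x) / θ) = θ / 2 := by
      rw [intervalIntegral.integral_sub (by simp) (Continuous.intervalIntegrable (by fun_prop) _ _),
        intervalIntegral.integral_div, intervalIntegral.integral_sub (by simp) (by simp),
        integral_id]
      simp
      field_simp
      ring
    rw [← e]
    exact intervalIntegral.integral_mono_on hxc.le (Continuous.intervalIntegrable (by fun_prop) _ _)
      (Continuous.intervalIntegrable (by fun_prop) _ _) hlow
  rw [← hI] at hhalf
  have hx1 : 0 < 1 - x := by linarith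
  have hc : 0 < ν * (1 - s) := mul_pos hν (by linarith)
  set z := ν * (1 - s) * (1 - x) with hz
  have hz0 : 0 < z := mul_pos hc hx1
  have hgain : θ / 2 ≤ (1 - x) * gain value z := by
    have := decay_eq ν s x
    rw [decay, mul_assoc] at this
    have := mul_left_cancel₀ hν.ne' this
    linarith
  have hz' : 0 ≤ ν * (1 - s) * (1 - (x + θ)) := mul_nonneg hc.le (by linarith)
  have hlt : ν * (1 - s) * (1 - (x + θ)) < z := by
    rw [hz]
    gcongr
  -- Second use of concavity: `gain value z` is the derivative at `z`, hence at most the slope of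
  -- the chord ending there, whose rise is at most `1` by `hend`. Multiplying the two bounds
  -- eliminates the unknown `gain value z`.
  have hslope := concaveOn_value.le_slope_of_hasDerivAt hz' hz0.le hlt (hasDerivAt_value hz0)
  rw [slope_def_field, le_div_iff₀ (by linarith)] at hslope
  have hsur : value z - value (ν * (1 - s) * (1 - (x + θ))) ≤ 1 := by
    unfold surplus reserve at hend
    linarith
  have hdz : z - ν * (1 - s) * (1 - (x + θ)) = ν * (1 - s) * θ := by rw [hz]; ring
  rw [hdz] at hslope
  have h2 : gain value z * (ν * (1 - s) * θ) ≤ 1 := hslope.trans hsur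
  calc ν * (1 - s) * θ ^ 2 = 2 * (ν * (1 - s) * θ) * (θ / 2) := by ring
    _ ≤ 2 * (ν * (1 - s) * θ) * ((1 - x) * gain value z) := by gcongr
    _ = 2 * (1 - x) * (gain value z * (ν * (1 - s) * θ)) := by ring
    _ ≤ 2 * (1 - x) * 1 := by gcongr
    _ = 2 * (1 - x) := by ring

/-- The control that selects exactly the marks with positive surplus. -/
def greedyControl (ν s x : ℝ) : ℝ :=
  volume.real {r : ℝ | (x < r ∧ r ≤ 1) ∧ 0 < surplus ν s x r}

lemma greedyControl_nonneg (ν s x : ℝ) : 0 ≤ greedyControl ν s x := ENNReal.toReal_nonneg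

lemma greedyControl_le {ν s x : ℝ} (hx : x ≤ 1) : greedyControl ν s x ≤ 1 - x := by
  have : greedyControl ν s x ≤ volume.real (Ioc x 1) :=
    measureReal_mono (fun r hr => hr.1) (by simp)
  simpa [hx] using this

lemma feasible_greedyControl (ν : ℝ) : Feasible (greedyControl ν) where
  measurable := by
    have hc : Continuous fun p : (ℝ × ℝ) × ℝ => surplus ν p.1.1 p.1.2 p.2 :=
      continuous_const.sub ((continuous_reserve_sub ν).comp
        (by fun_prop : Continuous fun p : (ℝ × ℝ) × ℝ => (p.1.1, p.1.2, p.2)))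
    have hset : MeasurableSet {p : (ℝ × ℝ) × ℝ |
        (p.1.2 < p.2 ∧ p.2 ≤ 1) ∧ 0 < surplus ν p.1.1 p.1.2 p.2} :=
      ((measurableSet_lt measurable_fst.snd measurable_snd).inter
        (measurableSet_le measurable_snd measurable_const)).inter
        (measurableSet_lt measurable_const hc.measurable)
    exact (measurable_measure_prodMk_left (ν := volume) hset).ennreal_toReal
  nonneg t _ x _ := greedyControl_nonneg ν t x
  le t _ x hx := greedyControl_le hx.2

lemma greedyControl_rate {ν : ℝ} (hν : 0 < ν) {s x : ℝ} (hs : s ≤ 1) (hx : x ≤ 1) :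
    decay ν s x + jumpRate ν (greedyControl ν) s x = ν * greedyControl ν s x := by
  set θ := greedyControl ν s x with hθ
  have h0 : 0 ≤ θ := greedyControl_nonneg ν s x
  have h1 : θ ≤ 1 - x := greedyControl_le hx
  have hfin : volume {r : ℝ | (x < r ∧ r ≤ 1) ∧ 0 < surplus ν s x r} ≠ ∞ :=
    ((measure_mono (t := Ioc x 1) fun r hr => hr.1).trans_lt (by simp)).ne
  -- The surplus is nonincreasing in `r`, so a set of positive surplus with measure `θ` is, up to an
  -- endpoint, the interval from `x` to `x + θ`.
  have hin : ∀ r, x < r → r < x + θ → 0 < surplus ν s x r := by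
    intro r hr hrθ
    by_contra hneg
    have : θ ≤ volume.real (Ioc x r) := by
      refine measureReal_mono (fun q hq => ⟨hq.1.1, ?_⟩) (by simp)
      by_contra hqr
      have := surplus_anti (x := x) hν hs (not_le.1 hqr).le hq.1.2
      linarith [hq.2]
    rw [volume_real_Ioc_of_le hr.le] at this
    linarith
  have hout : ∀ r, x + θ < r → r ≤ 1 → surplus ν s x r ≤ 0 := by
    intro r hr hr1
    by_contra hpos
    have : volume.real (Ioc x r) ≤ θ := by
      refine measureReal_mono (fun q hq => ⟨⟨hq.1, hq.2.trans hr1⟩, ?_⟩) hfin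
      have := surplus_anti (x := x) hν hs hq.2 hr1
      linarith
    rw [volume_real_Ioc_of_le (by linarith)] at this
    linarith
  have hI : ∫ r in x..1, max (surplus ν s x r) 0 = ∫ r in x..(x + θ), surplus ν s x r := by
    rw [← intervalIntegral.integral_add_adjacent_intervals (b := x + θ)
      (Continuous.intervalIntegrable (by fun_prop) _ _)
      (Continuous.intervalIntegrable (by fun_prop) _ _)]
    have e1 : ∫ r in (x + θ)..1, max (surplus ν s x r) 0 = 0 := by
      rw [intervalIntegral.integral_of_le (by linarith)]
      refine integral_eq_zero_of_ae ?_
      filter_upwards [ae_restrict_mem measurableSet_Ioc] with r hr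
      exact max_eq_right (hout r hr.1 hr.2)
    rw [e1, add_zero]
    have : ∀ᵐ r : ℝ, r ≠ x + θ := Measure.ae_ne volume _
    refine intervalIntegral.integral_congr_ae ?_
    filter_upwards [this] with r hr1 hr
    rw [uIoc_of_le (by linarith)] at hr
    exact max_eq_left (hin r hr.1 (lt_of_le_of_ne hr.2 hr1)).le
  rw [rate_eq, ← hθ, decay_eq, hI]
  ring

lemma meanLength_greedyControl {ν : ℝ} (hν : 0 < ν) :
    ENNReal.ofReal (meanLength (greedyControl ν) ν 1) = ENNReal.ofReal (value ν) := by
  have hf := feasible_greedyControl ν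
  rw [ofReal_value hν hf, ofReal_meanLength hν hf]
  refine setLIntegral_congr_fun measurableSet_Ioc fun s hs => lintegral_congr fun ω => ?_
  have hx := runningMax_mem (greedyControl ν) s ω
  have hj := jumpRate_nonneg hν hs.2 (greedyControl_nonneg ν s (runningMax (greedyControl ν) s ω))
    (greedyControl_le hx.2)
  rw [← greedyControl_rate hν hs.2 hx.2, ENNReal.ofReal_add (decay_nonneg hν hx.2) hj]

lemma measurable_jumpRate (ν : ℝ) {ψ : ℝ → ℝ → ℝ} (hψ : Measurable (Function.uncurry ψ)) :
    Measurable fun p : ℝ × ℝ => jumpRate ν ψ p.1 p.2 := by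
  have hr := continuous_reserve ν
  have h1 : ∀ b : ℝ × ℝ × ℝ → ℝ, Continuous b → Continuous fun q : ℝ × ℝ × ℝ =>
      ∫ r in (0 : ℝ)..b q, (reserve ν q.1 q.2.1 - reserve ν q.1 r) := fun b hb => by
    refine intervalIntegral.continuous_parametric_intervalIntegral_of_continuous
      (f := fun (q : ℝ × ℝ × ℝ) r => reserve ν q.1 q.2.1 - reserve ν q.1 r) ?_ hb
    exact (hr.comp (by fun_prop : Continuous fun w : (ℝ × ℝ × ℝ) × ℝ => (w.1.1, w.1.2.1))).sub
      (hr.comp (by fun_prop : Continuous fun w : (ℝ × ℝ × ℝ) × ℝ => (w.1.1, w.2)))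
  have h2 : Continuous fun q : ℝ × ℝ × ℝ => ν *
      ∫ r in q.2.1..(q.2.1 + q.2.2), (reserve ν q.1 q.2.1 - reserve ν q.1 r) := by
    refine continuous_const.mul (((h1 (fun q => q.2.1 + q.2.2) (by fun_prop)).sub
      (h1 (fun q => q.2.1) (by fun_prop))).congr fun q => ?_)
    exact intervalIntegral.integral_interval_sub_left
      (Continuous.intervalIntegrable (by fun_prop) _ _)
      (Continuous.intervalIntegrable (by fun_prop) _ _)
  have h3 : Measurable fun p : ℝ × ℝ => (p.1, p.2, ψ p.1 p.2) :=
    measurable_fst.prodMk (measurable_snd.prodMk hψ)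
  unfold jumpRate
  simpa only [Function.comp_def] using h2.measurable.comp h3

/-- Comparison with `greedyControl` forces equality in the integrated form of `rate_le`. The
integrals are finite, so equality holds for almost every time and then for almost every sample. -/
lemma IsOptimal.ae_sq_le {ν : ℝ} (hν : 0 < ν) {ψ : ℝ → ℝ → ℝ} (hψ : IsOptimal ν ψ) :
    ∀ᵐ s ∂volume.restrict (Ioc 0 1), ∀ᵐ ω ∂sampleLaw ν,
      ν * (1 - s) * ψ s (runningMax ψ s ω) ^ 2 ≤ 2 * (1 - runningMax ψ s ω) := by
  have := isProbabilityMeasure_sampleLaw hν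
  have hf := hψ.1
  set c : ℝ → Sample → ℝ≥0∞ := fun s ω => ENNReal.ofReal (ν * ψ s (runningMax ψ s ω)) with hc
  set d : ℝ → Sample → ℝ≥0∞ := fun s ω => ENNReal.ofReal (decay ν s (runningMax ψ s ω)) +
    ENNReal.ofReal (jumpRate ν ψ s (runningMax ψ s ω)) with hd
  have hdm : Measurable fun p : ℝ × Sample => d p.1 p.2 :=
    (measurable_decay_runningMax hf ν).add ((measurable_jumpRate ν hf.measurable).comp
      (measurable_fst.prodMk (measurable_runningMax hf.measurable))).ennreal_ofReal
  have hbd : ∀ s ∈ Ioc (0 : ℝ) 1, ∀ ω, 0 ≤ ψ s (runningMax ψ s ω) ∧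
      ψ s (runningMax ψ s ω) ≤ 1 - runningMax ψ s ω := fun s hs ω =>
    ⟨hf.nonneg s ⟨hs.1.le, hs.2⟩ _ (runningMax_mem ψ s ω),
      hf.le s ⟨hs.1.le, hs.2⟩ _ (runningMax_mem ψ s ω)⟩
  have hde : ∀ s ∈ Ioc (0 : ℝ) 1, ∀ ω, d s ω =
      ENNReal.ofReal (decay ν s (runningMax ψ s ω) + jumpRate ν ψ s (runningMax ψ s ω)) :=
    fun s hs ω => (ENNReal.ofReal_add (decay_nonneg hν (runningMax_mem ψ s ω).2)
      (jumpRate_nonneg hν hs.2 (hbd s hs ω).1 (hbd s hs ω).2)).symm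
  have hcd : ∀ s ∈ Ioc (0 : ℝ) 1, ∀ ω, c s ω ≤ d s ω := fun s hs ω => by
    rw [hde s hs]
    exact ENNReal.ofReal_le_ofReal (rate_le hν (hbd s hs ω).1 (hbd s hs ω).2)
  have hcfin : ∀ s ∈ Ioc (0 : ℝ) 1, ∫⁻ ω, c s ω ∂sampleLaw ν ≤ ENNReal.ofReal ν := fun s hs => by
    refine (lintegral_mono (g := fun _ => ENNReal.ofReal ν) fun ω => ?_).trans (by simp)
    have := control_mem hf (s := s) ⟨hs.1.le, hs.2⟩ ω
    exact ENNReal.ofReal_le_ofReal (by nlinarith [this.2])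
  have htot : ∫⁻ s in Ioc 0 1, ∫⁻ ω, d s ω ∂sampleLaw ν ≤
      ∫⁻ s in Ioc 0 1, ∫⁻ ω, c s ω ∂sampleLaw ν := by
    rw [← ofReal_value hν hf, ← ofReal_meanLength hν hf, ← meanLength_greedyControl hν]
    exact ENNReal.ofReal_le_ofReal (hψ.2 _ (feasible_greedyControl ν))
  have houter := ae_eq_of_ae_le_of_lintegral_le (μ := volume.restrict (Ioc (0 : ℝ) 1))
    (f := fun s => ∫⁻ ω, c s ω ∂sampleLaw ν) (g := fun s => ∫⁻ ω, d s ω ∂sampleLaw ν)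
    ((ae_restrict_mem measurableSet_Ioc).mono fun s hs => lintegral_mono (hcd s hs))
    ((setLIntegral_mono (g := fun _ => ENNReal.ofReal ν) (by fun_prop) hcfin).trans_lt
      (by simp)).ne
    hdm.lintegral_prod_right'.aemeasurable htot
  filter_upwards [houter, ae_restrict_mem measurableSet_Ioc] with s hs hs1
  have hinner := ae_eq_of_ae_le_of_lintegral_le (μ := sampleLaw ν) (f := c s) (g := d s)
    (Eventually.of_forall (hcd s hs1)) ((hcfin s hs1).trans_lt ENNReal.ofReal_lt_top).ne
    (by simpa only [Function.comp_def] using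
      (hdm.comp (measurable_prodMk_left (x := s))).aemeasurable) hs.ge
  filter_upwards [hinner] with ω hω
  have hb := hbd s hs1 ω
  have hx := runningMax_mem ψ s ω
  rcases hs1.2.eq_or_lt with rfl | hlt
  · simp only [sub_self, mul_zero, zero_mul]
    linarith [hx.2]
  · rw [hde s hs1, ENNReal.ofReal_eq_ofReal_iff (mul_nonneg hν.le hb.1)
      (add_nonneg (decay_nonneg hν hx.2) (jumpRate_nonneg hν hs1.2 hb.1 hb.2))] at hω
    exact sq_le_of_rate_eq hν hlt hb.1 hb.2 hω.symm

/-! ### Barriers for the differential inequalities -/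

/-- After the last time `c` at which `p ≤ D`, the path lies strictly above `D` and hence grows no
faster than `D`, so it cannot end above `D`. The slope condition is needed only above the barrier.
-/
lemma le_of_crossing {p γ D d : ℝ → ℝ} {a b : ℝ} (hab : a ≤ b)
    (hγ : IntervalIntegrable γ volume a b)
    (hp : ∀ t ∈ Icc a b, p t = p a + ∫ s in a..t, γ s)
    (hD : ∀ s ∈ Icc a b, HasDerivAt D (d s) s) (hd : ContinuousOn d (Icc a b))
    (h : ∀ᵐ s, s ∈ Ioc a b → D s < p s → γ s ≤ d s) (ha : p a ≤ D a) : p b ≤ D b := by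
  by_contra! hb
  have hpc : ContinuousOn p (Icc a b) := by
    have h1 := intervalIntegral.continuousOn_primitive_interval' hγ left_mem_uIcc
    rw [uIcc_of_le hab] at h1
    exact (continuousOn_const.add h1).congr hp
  have hDc : ContinuousOn D (Icc a b) := fun s hs => (hD s hs).continuousAt.continuousWithinAt
  have hS : IsCompact (Icc a b ∩ (fun s => p s - D s) ⁻¹' Iic 0) :=
    isCompact_Icc.of_isClosed_subset
      ((hpc.sub hDc).preimage_isClosed_of_isClosed isClosed_Icc isClosed_Iic) inter_subset_left
  have hne : (Icc a b ∩ (fun s => p s - D s) ⁻¹' Iic 0).Nonempty :=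
    ⟨a, left_mem_Icc.2 hab, by simpa using ha⟩
  set c := sSup (Icc a b ∩ (fun s => p s - D s) ⁻¹' Iic 0) with hc
  have hcS := hS.sSup_mem hne
  rw [← hc] at hcS
  have hcb : c ≤ b := hcS.1.2
  have hc0 : p c ≤ D c := by simpa using hcS.2
  have hgt : ∀ s ∈ Ioc c b, D s < p s := by
    intro s hs
    by_contra! hle
    have : s ≤ c := le_csSup hS.bddAbove ⟨⟨hcS.1.1.trans hs.1.le, hs.2⟩, by simpa using hle⟩
    linarith [hs.1]
  have hγ1 : IntervalIntegrable γ volume a c := hγ.mono_set (by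
    rw [uIcc_of_le hab, uIcc_of_le hcS.1.1]; exact Icc_subset_Icc_right hcb)
  have hγ2 : IntervalIntegrable γ volume c b := hγ.mono_set (by
    rw [uIcc_of_le hab, uIcc_of_le hcb]; exact Icc_subset_Icc_left hcS.1.1)
  have hdi : IntervalIntegrable d volume c b := by
    refine ContinuousOn.intervalIntegrable ?_
    rw [uIcc_of_le hcb]
    exact hd.mono (Icc_subset_Icc_left hcS.1.1)
  have e1 : p b - p c = ∫ s in c..b, γ s := by
    rw [hp b (right_mem_Icc.2 hab), hp c hcS.1,
      ← intervalIntegral.integral_add_adjacent_intervals hγ1 hγ2]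
    ring
  have e2 : ∫ s in c..b, d s = D b - D c := by
    refine intervalIntegral.integral_eq_sub_of_hasDerivAt (fun s hs => ?_) hdi
    rw [uIcc_of_le hcb] at hs
    exact hD s ⟨hcS.1.1.trans hs.1, hs.2⟩
  have e3 : ∫ s in c..b, γ s ≤ ∫ s in c..b, d s := by
    refine intervalIntegral.integral_mono_ae_restrict hcb hγ2 hdi ?_
    have : ∀ᵐ s : ℝ, s ≠ c := Measure.ae_ne volume c
    filter_upwards [ae_restrict_of_ae h, ae_restrict_of_ae this,
      ae_restrict_mem measurableSet_Icc] with s hs hsc hm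
    have hm' : s ∈ Ioc c b := ⟨lt_of_le_of_ne hm.1 hsc.symm, hm.2⟩
    exact hs ⟨hcS.1.1.trans_lt hm'.1, hm'.2⟩ (hgt s hm')
  linarith

/-- Algebraic core of the upper barrier. -/
lemma barrier_step {b u w h h' : ℝ} (hb : 0 ≤ b) (hu : 0 < u) (hh : 0 ≤ h)
    (hw : w ^ 2 * u ≤ u - (b * (1 - u) + b ^ 2 / 4 * h))
    (hh' : 1 ≤ u * h - u ^ 2 * h' + 2 * (1 - u)) :
    w ^ 2 + b / u * w + b ^ 2 / (4 * u ^ 2) ≤ 1 + b - b ^ 2 / 4 * h' := by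
  set δ := b * (1 - u) + b ^ 2 / 4 * h with hδ
  have h1 : w ^ 2 ≤ 1 - δ / u := by
    rw [← mul_le_mul_iff_left₀ hu, sub_mul, div_mul_cancel₀ _ hu.ne']
    linarith
  -- Tangent bound `w ≤ (1 + w²) / 2` for the square root at `1`.
  have h2 : w ≤ 1 - δ / (2 * u) := by
    have : δ / (2 * u) = δ / u / 2 := by field_simp
    nlinarith [sq_nonneg (w - 1)]
  have h3 : b / u * w ≤ b / u * (1 - δ / (2 * u)) := by gcongr
  -- The terms of first order in `b` cancel. Those of second order are controlled by `hh'`, where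
  -- `h'` is the derivative of `h` in `u = 1 - t`, and the cubic term `b * h / 2` has the favourable
  -- sign.
  have h4 : 1 - δ / u + b / u * (1 - δ / (2 * u)) + b ^ 2 / (4 * u ^ 2) ≤
      1 + b - b ^ 2 / 4 * h' := by
    rw [← sub_nonneg]
    have e : 1 + b - b ^ 2 / 4 * h' -
        (1 - δ / u + b / u * (1 - δ / (2 * u)) + b ^ 2 / (4 * u ^ 2)) =
        b ^ 2 / 4 * (u * h - u ^ 2 * h' + 2 * (1 - u) - 1 + b * h / 2) / u ^ 2 := by
      rw [hδ]
      field_simp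
      ring
    rw [e]
    have : 0 ≤ b * h := mul_nonneg hb hh
    have : 0 ≤ u * h - u ^ 2 * h' + 2 * (1 - u) - 1 + b * h / 2 := by linarith
    positivity
  linarith

/-- The barrier is `t + b t + (b² / 4) h`. Equality in the condition of `barrier_step` with `h = 0`
at `t = 0` gives `h = 2 - (3/2) u - 1 / (2u)`, `u = 1 - t`, which increases up to `u = 1/√3`, where
it equals `2 - √3`. From there on the constant `2 - √3` satisfies the condition, precisely because
`√3 u ≤ 1`. -/
lemma upper_barrier {p γ : ℝ → ℝ} {b : ℝ} (hb : 0 ≤ b)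
    (hγ : IntervalIntegrable γ volume 0 1)
    (hp : ∀ t ∈ Icc (0 : ℝ) 1, p t = ∫ s in (0 : ℝ)..t, γ s) (hp1 : ∀ t ∈ Icc (0 : ℝ) 1, p t ≤ 1)
    (h : ∀ᵐ s, s ∈ Ioo (0 : ℝ) 1 → γ s ≤ √((1 - p s) / (1 - s)) ^ 2 +
      b / (1 - s) * √((1 - p s) / (1 - s)) + b ^ 2 / (4 * (1 - s) ^ 2))
    {t : ℝ} (ht : t ∈ Icc (0 : ℝ) 1) : p t - t ≤ b * t + (2 - √3) * (b ^ 2 / 4) := by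
  have h3 : √3 ^ 2 = 3 := Real.sq_sqrt (by norm_num)
  have h30 : 0 < √3 := by positivity
  have h32 : √3 < 2 := by nlinarith
  have h31 : 1 < √3 := by nlinarith
  have hsub : ∀ a b : ℝ, 0 ≤ a → a ≤ b → b ≤ 1 → IntervalIntegrable γ volume a b :=
    fun a b ha hab hb => hγ.mono_set (by
      rw [uIcc_of_le hab, uIcc_of_le zero_le_one]; exact Icc_subset_Icc ha hb)
  have hp' : ∀ a b : ℝ, 0 ≤ a → b ≤ 1 → ∀ t ∈ Icc a b, p t = p a + ∫ s in a..t, γ s := by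
    intro a b ha hb t ht
    rw [hp t ⟨ha.trans ht.1, ht.2.trans hb⟩, hp a ⟨ha, ht.1.trans (ht.2.trans hb)⟩,
      intervalIntegral.integral_add_adjacent_intervals (hsub 0 a le_rfl ha (ht.1.trans (ht.2.trans hb)))
        (hsub a t ha ht.1 (ht.2.trans hb))]
  have hw : ∀ s ∈ Ioo (0 : ℝ) 1, ∀ D, D ≤ p s →
      √((1 - p s) / (1 - s)) ^ 2 * (1 - s) ≤ 1 - D := by
    intro s hs D hD
    have hu : 0 < 1 - s := by linarith [hs.2]
    have := hp1 s ⟨hs.1.le, hs.2.le⟩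
    rw [Real.sq_sqrt (div_nonneg (by linarith) hu.le), div_mul_cancel₀ _ hu.ne']
    linarith
  set t₀ : ℝ := 1 - 1 / √3 with ht₀
  have ht₀0 : 0 ≤ t₀ := by
    rw [ht₀, sub_nonneg, div_le_one h30]; exact h31.le
  have ht₀1 : t₀ < 1 := by rw [ht₀]; have : 0 < 1 / √3 := by positivity
                           linarith
  set D : ℝ → ℝ := fun t => t + b * t + b ^ 2 / 4 * (2 - 3 / 2 * (1 - t) - 1 / 2 * (1 - t)⁻¹) with hDdef
  have stage1 : ∀ t ∈ Icc 0 t₀, p t ≤ D t := by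
    intro t ht
    have hu1 : ∀ s ∈ Icc 0 t, 1 / √3 ≤ 1 - s := fun s hs => by linarith [hs.2, ht.2]
    have hupos : ∀ s ∈ Icc 0 t, 0 < 1 - s := fun s hs => lt_of_lt_of_le (by positivity) (hu1 s hs)
    refine le_of_crossing (d := fun s => 1 + b - b ^ 2 / 4 * (-(3 / 2) + 1 / 2 * ((1 - s) ^ 2)⁻¹)) ht.1
      (hsub 0 t le_rfl ht.1 (by linarith [ht.2])) (hp' 0 t le_rfl (by linarith [ht.2])) ?_ ?_ ?_ ?_
    · intro s hs
      have h1 := (hasDerivAt_id s).const_sub 1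
      have h2 := h1.inv (hupos s hs).ne'
      have h3 := ((hasDerivAt_id s).add ((hasDerivAt_id s).const_mul b)).add
        (((h1.const_mul (3 / 2)).const_sub 2).sub (h2.const_mul (1 / 2)) |>.const_mul (b ^ 2 / 4))
      refine h3.congr_deriv ?_
      have := (hupos s hs).ne'
      simp only [id]
      field_simp
      ring
    · refine ContinuousOn.sub continuousOn_const (ContinuousOn.mul continuousOn_const
        (ContinuousOn.add continuousOn_const (ContinuousOn.mul continuousOn_const
          (ContinuousOn.inv₀ (by fun_prop) fun s hs => ?_))))
      exact pow_ne_zero _ (hupos s hs).ne'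
    · filter_upwards [h] with s hs hst hlt
      have hs01 : s ∈ Ioo (0 : ℝ) 1 := ⟨hst.1, by linarith [hst.2, ht.2]⟩
      have hu := hupos s ⟨hst.1.le, hst.2⟩
      have hu' := hu1 s ⟨hst.1.le, hst.2⟩
      refine (hs hs01).trans ?_
      refine barrier_step (h := 2 - 3 / 2 * (1 - s) - 1 / 2 * (1 - s)⁻¹) hb hu ?_ ?_ ?_
      · have e : 2 - 3 / 2 * (1 - s) - 1 / 2 * (1 - s)⁻¹ = s * (3 * (1 - s) - 1) / (2 * (1 - s)) := by
          field_simp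
          ring
        have : 1 / 3 ≤ 1 / √3 := one_div_le_one_div_of_le h30 (by nlinarith)
        rw [e]
        exact div_nonneg (mul_nonneg hst.1.le (by linarith)) (by linarith)
      · refine (hw s hs01 _ hlt.le).trans_eq ?_
        simp only [hDdef]
        ring
      · have e : (1 - s) * (2 - 3 / 2 * (1 - s) - 1 / 2 * (1 - s)⁻¹) -
            (1 - s) ^ 2 * (-(3 / 2) + 1 / 2 * ((1 - s) ^ 2)⁻¹) + 2 * (1 - (1 - s)) = 1 := by
          field_simp
          ring
        rw [e]
    · rw [hp 0 (by simp)]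
      simp [hDdef]
      norm_num
  have hDle : ∀ t ∈ Icc 0 t₀, D t ≤ t + b * t + (2 - √3) * (b ^ 2 / 4) := by
    intro t ht
    have hu : 0 < 1 - t := by linarith [ht.2]
    have : 2 - 3 / 2 * (1 - t) - 1 / 2 * (1 - t)⁻¹ ≤ 2 - √3 := by
      have e : 3 / 2 * (1 - t) + 1 / 2 * (1 - t)⁻¹ - √3 =
          (√3 * (1 - t) - 1) ^ 2 / (2 * (1 - t)) := by
        field_simp
        linear_combination (-(1 - t) ^ 2) * h3
      have : 0 ≤ (√3 * (1 - t) - 1) ^ 2 / (2 * (1 - t)) := by positivity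
      linarith
    simp only [hDdef]
    nlinarith [sq_nonneg b]
  rcases le_total t t₀ with htt | htt
  · have := stage1 t ⟨ht.1, htt⟩
    have := hDle t ⟨ht.1, htt⟩
    linarith
  rcases ht.2.eq_or_lt with rfl | ht1
  · have := hp1 1 ht
    have : 0 ≤ (2 - √3) * (b ^ 2 / 4) := mul_nonneg (by linarith) (by positivity)
    linarith
  have hfin : p t ≤ (fun t => t + b * t + b ^ 2 / 4 * (2 - √3)) t := by
    refine le_of_crossing (D := fun t => t + b * t + b ^ 2 / 4 * (2 - √3)) (d := fun s => 1 + b) htt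
      (hsub t₀ t ht₀0 htt ht.2) (hp' t₀ t ht₀0 ht.2) ?_ continuousOn_const ?_ ?_
    · intro s hs
      have h3 := ((hasDerivAt_id s).add ((hasDerivAt_id s).const_mul b)).add_const (b ^ 2 / 4 * (2 - √3))
      refine h3.congr_deriv ?_
      simp
    · filter_upwards [h] with s hs hst hlt
      have hs01 : s ∈ Ioo (0 : ℝ) 1 := ⟨ht₀0.trans_lt hst.1, by linarith [hst.2]⟩
      have hu : 0 < 1 - s := by linarith [hs01.2]
      refine (hs hs01).trans ?_
      have := barrier_step (h := 2 - √3) (h' := 0) (w := √((1 - p s) / (1 - s))) hb hu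
        (by linarith) ?_ ?_
      · simpa using this
      · refine (hw s hs01 _ hlt.le).trans_eq ?_
        ring
      · have h1 : √3 * (1 - s) ≤ 1 := by
          have : 1 - s ≤ 1 / √3 := by linarith [hst.1]
          rw [le_div_iff₀ h30] at this
          linarith
        linarith
    · have := stage1 t₀ ⟨ht₀0, le_rfl⟩
      have := hDle t₀ ⟨ht₀0, le_rfl⟩
      linarith
  dsimp only at hfin
  linarith

/-- In terms of `w = √((1 - p) / u)`, `u = 1 - t`, the extremal equation becomes `dw/dt = b /
(2u²)`, with solution `r = 1 + (b/2)(1/u - 1)`; the barrier is `B = 1 - u r²`. Near `t = 1`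
monotonicity of `p` takes over. -/
lemma lower_barrier {p γ : ℝ → ℝ} {b : ℝ} (hb : 0 < b)
    (hγ : IntervalIntegrable γ volume 0 1) (hγ0 : ∀ s ∈ Icc (0 : ℝ) 1, 0 ≤ γ s)
    (hp : ∀ t ∈ Icc (0 : ℝ) 1, p t = ∫ s in (0 : ℝ)..t, γ s) (hp1 : ∀ t ∈ Icc (0 : ℝ) 1, p t ≤ 1)
    (h : ∀ᵐ s, s ∈ Ioo (0 : ℝ) 1 → √((1 - p s) / (1 - s)) ^ 2 -
      b / (1 - s) * √((1 - p s) / (1 - s)) ≤ γ s)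
    {t : ℝ} (ht : t ∈ Icc (0 : ℝ) 1) : -(2 * b) ≤ p t - t := by
  have hsub : ∀ a b : ℝ, 0 ≤ a → a ≤ b → b ≤ 1 → IntervalIntegrable γ volume a b :=
    fun a b ha hab hb => hγ.mono_set (by
      rw [uIcc_of_le hab, uIcc_of_le zero_le_one]; exact Icc_subset_Icc ha hb)
  have hmono : ∀ a b : ℝ, 0 ≤ a → a ≤ b → b ≤ 1 → p a ≤ p b := by
    intro a b ha hab hb
    rw [hp a ⟨ha, hab.trans hb⟩, hp b ⟨ha.trans hab, hb⟩,
      ← intervalIntegral.integral_add_adjacent_intervals (hsub 0 a le_rfl ha (hab.trans hb))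
        (hsub a b ha hab hb)]
    have : 0 ≤ ∫ s in a..b, γ s :=
      intervalIntegral.integral_nonneg hab fun s hs => hγ0 s ⟨ha.trans hs.1, hs.2.trans hb⟩
    linarith
  have hp0 : p 0 = 0 := by rw [hp 0 (by simp)]; simp
  -- For `b ≥ 1/2` the bound is at most `-1` and `p ≥ 0` suffices.
  rcases le_or_gt (1 / 2) b with hb2 | hb2
  · have := hmono 0 t le_rfl ht.1 ht.2
    linarith [ht.2]
  set B : ℝ → ℝ := fun t => 1 - ((1 - t) + b * t + b ^ 2 / 4 * ((1 - t)⁻¹ - 2 + (1 - t))) with hB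
  have stage : ∀ t ∈ Icc 0 (1 - b / 2), t - 3 / 2 * b ≤ p t := by
    intro t ht
    have hu1 : ∀ s ∈ Icc 0 t, b / 2 ≤ 1 - s := fun s hs => by linarith [hs.2, ht.2]
    have hupos : ∀ s ∈ Icc 0 t, 0 < 1 - s := fun s hs => lt_of_lt_of_le (by positivity) (hu1 s hs)
    have ht1 : t ≤ 1 := by linarith [ht.2]
    have key : -p t ≤ -B t := by
      refine le_of_crossing (p := fun t => -p t) (D := fun t => -B t) (γ := fun s => -γ s)
        (d := fun s => -(1 - b + b ^ 2 / 4 * (1 - ((1 - s) ^ 2)⁻¹))) ht.1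
        (hsub 0 t le_rfl ht.1 ht1).neg ?_ ?_ ?_ ?_ ?_
      · intro s hs
        rw [intervalIntegral.integral_neg, hp s ⟨hs.1, hs.2.trans ht1⟩, hp0]
        ring
      · intro s hs
        have h1 := (hasDerivAt_id s).const_sub 1
        have h2 := h1.inv (hupos s hs).ne'
        have h3 := (((h1.add ((hasDerivAt_id s).const_mul b)).add
          (((h2.sub_const 2).add h1).const_mul (b ^ 2 / 4))).const_sub 1).neg
        refine h3.congr_deriv ?_
        have := (hupos s hs).ne'
        simp only [id]
        field_simp
        ring
      · refine (ContinuousOn.add continuousOn_const (ContinuousOn.mul continuousOn_const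
          (ContinuousOn.sub continuousOn_const (ContinuousOn.inv₀ (by fun_prop) fun s hs => ?_)))).neg
        exact pow_ne_zero _ (hupos s hs).ne'
      · have hne : ∀ᵐ s : ℝ, s ≠ 1 := Measure.ae_ne volume 1
        filter_upwards [h] with s hs hst hlt
        have hu := hupos s ⟨hst.1.le, hst.2⟩
        have hs01 : s ∈ Ioo (0 : ℝ) 1 := ⟨hst.1, by linarith⟩
        refine neg_le_neg (le_trans ?_ (hs hs01))
        set u := 1 - s with hu'
        set w := √((1 - p s) / u) with hw
        set r := 1 + b / 2 * (u⁻¹ - 1) with hr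
        -- The function `x ↦ x² - (b / u) x` increases beyond `b / (2u)`, so from there `r ≤ w` can
        -- be inserted into it.
        have hr0 : b / (2 * u) ≤ r := by
          have : r - b / (2 * u) = 1 - b / 2 := by rw [hr]; field_simp; ring
          linarith
        have hrpos : 0 ≤ r := le_trans (by positivity) hr0
        have hps := hp1 s ⟨hst.1.le, hs01.2.le⟩
        have hrw : r ≤ w := by
          refine Real.le_sqrt_of_sq_le ?_
          rw [le_div_iff₀ hu]
          have e : r ^ 2 * u = 1 - B s := by
            have : s = 1 - u := by rw [hu']; ring
            simp only [hB, ← hu', hr]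
            rw [this]
            field_simp
            ring
          rw [e]
          linarith
        have e : 1 - b + b ^ 2 / 4 * (1 - (u ^ 2)⁻¹) = r ^ 2 - b / u * r := by
          rw [hr]
          field_simp
          ring
        rw [e]
        have hbu : b / u = 2 * (b / (2 * u)) := by field_simp
        nlinarith
      · simp [hB, hp0]
        norm_num
    have hu := hupos t ⟨ht.1, le_rfl⟩
    have hut := hu1 t ⟨ht.1, le_rfl⟩
    have hfrac : b ^ 2 / 4 * ((1 - t)⁻¹ - 2 + (1 - t)) ≤ b / 2 := by
      have h1 : (1 - t)⁻¹ - 2 + (1 - t) ≤ (b / 2)⁻¹ := by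
        have := inv_anti₀ (by positivity) hut
        linarith [ht.1]
      calc b ^ 2 / 4 * ((1 - t)⁻¹ - 2 + (1 - t)) ≤ b ^ 2 / 4 * (b / 2)⁻¹ := by gcongr
        _ = b / 2 := by field_simp; ring
    have : b * t ≤ b := by nlinarith
    simp only [hB] at key
    linarith
  rcases le_total t (1 - b / 2) with htt | htt
  · have := stage t ⟨ht.1, htt⟩
    linarith
  -- The deficit is at most `3b/2` at `1 - b/2`, and the remaining time adds at most `b/2`.
  · have h1 := stage (1 - b / 2) ⟨by linarith, le_rfl⟩
    have h2 := hmono (1 - b / 2) t (by linarith) htt ht.2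
    linarith [ht.2]

/-! ### Jensen's inequality and the bounds on the mean -/

lemma measurable_runningMax_section {ψ : ℝ → ℝ → ℝ} (hψ : Feasible ψ) (t : ℝ) :
    Measurable (runningMax ψ t) := by
  simpa only [Function.comp_def] using
    (measurable_runningMax hψ.measurable).comp (measurable_prodMk_left (x := t))

lemma integrable_runningMax {ν : ℝ} (hν : 0 < ν) {ψ : ℝ → ℝ → ℝ} (hψ : Feasible ψ) (t : ℝ) :
    Integrable (runningMax ψ t) (sampleLaw ν) := by
  have := isProbabilityMeasure_sampleLaw hν
  exact integrable_of_mem_Icc (measurable_runningMax_section hψ t) (runningMax_mem ψ t)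

lemma meanMax_le_one {ν : ℝ} (hν : 0 < ν) {ψ : ℝ → ℝ → ℝ} (hψ : Feasible ψ) (t : ℝ) :
    meanMax ψ ν t ≤ 1 := by
  have := isProbabilityMeasure_sampleLaw hν
  have h : meanMax ψ ν t ≤ ∫ _, (1 : ℝ) ∂sampleLaw ν :=
    integral_mono (integrable_runningMax hν hψ t) (integrable_const (1 : ℝ))
      fun ω => (runningMax_mem ψ t ω).2
  simpa using h

/-- The square root of the ratio between the remaining marks and the remaining time. -/
def rootRatio (ψ : ℝ → ℝ → ℝ) (s : ℝ) (ω : Sample) : ℝ := √((1 - runningMax ψ s ω) / (1 - s))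

lemma rootRatio_sq {ψ : ℝ → ℝ → ℝ} {s : ℝ} (hs : s < 1) (ω : Sample) :
    rootRatio ψ s ω ^ 2 = (1 - runningMax ψ s ω) / (1 - s) :=
  Real.sq_sqrt (div_nonneg (by linarith [(runningMax_mem ψ s ω).2]) (by linarith))

lemma integrable_rootRatio {ν : ℝ} (hν : 0 < ν) {ψ : ℝ → ℝ → ℝ} (hψ : Feasible ψ) {s : ℝ}
    (hs : s < 1) : Integrable (rootRatio ψ s) (sampleLaw ν) := by
  have := isProbabilityMeasure_sampleLaw hν
  have hm := measurable_runningMax_section hψ s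
  refine integrable_of_mem_Icc (a := 0) (b := √(1 / (1 - s)))
    ((hm.const_sub 1).div_const _).sqrt fun ω => ⟨Real.sqrt_nonneg _, Real.sqrt_le_sqrt ?_⟩
  have : 0 < 1 - s := by linarith
  gcongr
  linarith [(runningMax_mem ψ s ω).1]

lemma integral_rootRatio_sq {ν : ℝ} (hν : 0 < ν) {ψ : ℝ → ℝ → ℝ} (hψ : Feasible ψ) {s : ℝ}
    (hs : s < 1) : Integrable (fun ω => rootRatio ψ s ω ^ 2) (sampleLaw ν) ∧
    ∫ ω, rootRatio ψ s ω ^ 2 ∂sampleLaw ν = √((1 - meanMax ψ ν s) / (1 - s)) ^ 2 := by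
  have := isProbabilityMeasure_sampleLaw hν
  have hX := integrable_runningMax hν hψ s
  simp only [rootRatio_sq hs]
  refine ⟨((integrable_const _).sub hX).div_const _, ?_⟩
  rw [Real.sq_sqrt (div_nonneg (by linarith [meanMax_le_one hν hψ s]) (by linarith)),
    integral_div, integral_sub (integrable_const _) hX]
  simp [meanMax]

/-- Jensen's inequality, obtained by integrating `(W - m)² ≥ 0` with `m` the mean of `W`. -/
lemma integral_rootRatio_le {ν : ℝ} (hν : 0 < ν) {ψ : ℝ → ℝ → ℝ} (hψ : Feasible ψ) {s : ℝ}
    (hs : s < 1) : ∫ ω, rootRatio ψ s ω ∂sampleLaw ν ≤ √((1 - meanMax ψ ν s) / (1 - s)) := by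
  have := isProbabilityMeasure_sampleLaw hν
  obtain ⟨h2i, h2⟩ := integral_rootRatio_sq hν hψ hs
  have h1i := integrable_rootRatio hν hψ hs
  set m := ∫ ω, rootRatio ψ s ω ∂sampleLaw ν with hm
  refine le_of_sq_le_sq ?_ (Real.sqrt_nonneg _)
  rw [← h2]
  have h := integral_mono (((h1i.const_mul (2 * m)).sub (integrable_const (m ^ 2)))) h2i
    fun ω => show 2 * m * rootRatio ψ s ω - m ^ 2 ≤ rootRatio ψ s ω ^ 2 by
      nlinarith [sq_nonneg (rootRatio ψ s ω - m)]
  have e : ∫ ω, (2 * m * rootRatio ψ s ω - m ^ 2) ∂sampleLaw ν = m ^ 2 := by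
    rw [integral_sub (h1i.const_mul _) (integrable_const _), integral_const_mul, ← hm]
    simp
    ring
  have h' : ∫ ω, (2 * m * rootRatio ψ s ω - m ^ 2) ∂sampleLaw ν ≤ _ := h
  rwa [e] at h'

lemma drift_le {ν : ℝ} (hν : 0 < ν) {ψ : ℝ → ℝ → ℝ} (hψ : Feasible ψ) {s : ℝ}
    (hs : s ∈ Ico (0 : ℝ) 1) {c e : ℝ} (hc : 0 ≤ c)
    (h : ∀ᵐ ω ∂sampleLaw ν, ν * ψ s (runningMax ψ s ω) ^ 2 / 2 ≤
      rootRatio ψ s ω ^ 2 + c * rootRatio ψ s ω + e) :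
    drift ψ ν s ≤ √((1 - meanMax ψ ν s) / (1 - s)) ^ 2 +
      c * √((1 - meanMax ψ ν s) / (1 - s)) + e := by
  have := isProbabilityMeasure_sampleLaw hν
  obtain ⟨h2i, h2⟩ := integral_rootRatio_sq hν hψ hs.2
  have h1i := integrable_rootRatio hν hψ hs.2
  have hle := integral_mono_ae (integrable_drift hν hψ ⟨hs.1, hs.2.le⟩)
    ((h2i.add (h1i.const_mul c)).add (integrable_const e)) h
  have he : ∫ ω, (rootRatio ψ s ω ^ 2 + c * rootRatio ψ s ω + e) ∂sampleLaw ν =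
      √((1 - meanMax ψ ν s) / (1 - s)) ^ 2 + c * ∫ ω, rootRatio ψ s ω ∂sampleLaw ν + e := by
    have hsum : Integrable (fun ω => rootRatio ψ s ω ^ 2 + c * rootRatio ψ s ω) (sampleLaw ν) :=
      h2i.add (h1i.const_mul c)
    rw [integral_add hsum (integrable_const e),
      integral_add h2i (h1i.const_mul c), integral_const_mul, h2]
    simp
  have hle' : drift ψ ν s ≤ ∫ ω, (rootRatio ψ s ω ^ 2 + c * rootRatio ψ s ω + e) ∂sampleLaw ν := hle
  rw [he] at hle'
  have := mul_le_mul_of_nonneg_left (integral_rootRatio_le hν hψ hs.2) hc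
  linarith

lemma le_drift {ν : ℝ} (hν : 0 < ν) {ψ : ℝ → ℝ → ℝ} (hψ : Feasible ψ) {s : ℝ}
    (hs : s ∈ Ico (0 : ℝ) 1) {c : ℝ} (hc : 0 ≤ c)
    (h : ∀ ω, rootRatio ψ s ω ^ 2 - c * rootRatio ψ s ω ≤
      ν * ψ s (runningMax ψ s ω) ^ 2 / 2) :
    √((1 - meanMax ψ ν s) / (1 - s)) ^ 2 - c * √((1 - meanMax ψ ν s) / (1 - s)) ≤
      drift ψ ν s := by
  have := isProbabilityMeasure_sampleLaw hν
  obtain ⟨h2i, h2⟩ := integral_rootRatio_sq hν hψ hs.2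
  have h1i := integrable_rootRatio hν hψ hs.2
  have hle : ∫ ω, (rootRatio ψ s ω ^ 2 - c * rootRatio ψ s ω) ∂sampleLaw ν ≤ drift ψ ν s :=
    integral_mono (h2i.sub (h1i.const_mul c)) (integrable_drift hν hψ ⟨hs.1, hs.2.le⟩) h
  rw [integral_sub h2i (h1i.const_mul c), integral_const_mul, h2] at hle
  have := mul_le_mul_of_nonneg_left (integral_rootRatio_le hν hψ hs.2) hc
  linarith

lemma critical_eq {ν u y : ℝ} (hν : 0 < ν) : √(2 * y / (ν * u)) = √2 / √ν * √(y / u) := by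
  rw [← Real.sqrt_div (by norm_num), ← Real.sqrt_mul (by positivity)]
  congr 1
  rw [mul_div_mul_comm]

lemma Squeezed.meanMax_le {βm βp ν : ℝ} (hν : 0 < ν) (hβp : 0 ≤ βp) {ψ : ℝ → ℝ → ℝ}
    (hψ : Feasible ψ) (hsq : Squeezed βm βp ν ψ) {t : ℝ} (ht : t ∈ Icc (0 : ℝ) 1) :
    meanMax ψ ν t - t ≤ βp * √2 * t / √ν + (2 - √3) * βp ^ 2 / (2 * ν) := by
  have hν2 : √ν ^ 2 = ν := Real.sq_sqrt hν.le
  have h22 : √2 ^ 2 = 2 := Real.sq_sqrt (by norm_num)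
  have hν0 : 0 < √ν := Real.sqrt_pos.2 hν
  -- This `b` satisfies `b² / 4 = βp² / (2ν)`, matching both correction terms of the squared
  -- squeeze.
  have h := upper_barrier (p := meanMax ψ ν) (γ := drift ψ ν) (b := βp * √2 / √ν) (by positivity)
    (intervalIntegrable_drift hν hψ (by simp) (by simp)) (fun t ht => meanMax_eq hν hψ ht)
    (fun t _ => meanMax_le_one hν hψ t) (Eventually.of_forall fun s hs => ?_) ht
  · convert h using 2
    · ring
    · rw [div_pow, mul_pow, hν2, h22]
      field_simp
      ring
  · have hu : 0 < 1 - s := by linarith [hs.2]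
    have hs' : s ∈ Icc (0 : ℝ) 1 := ⟨hs.1.le, hs.2.le⟩
    refine drift_le hν hψ ⟨hs.1.le, hs.2⟩ (by positivity) (Eventually.of_forall fun ω => ?_)
    have hx := runningMax_mem ψ s ω
    have h0 := hψ.nonneg s hs' _ hx
    have hle : ψ s (runningMax ψ s ω) ≤ √2 / √ν * rootRatio ψ s ω + βp / (ν * (1 - s)) := by
      -- The squeeze says nothing at level `1`, but there feasibility forces the control to vanish.
      rcases hx.2.eq_or_lt with hx1 | hx1
      · have := hψ.le s hs' _ hx
        rw [hx1, sub_self] at this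
        rw [hx1]
        refine this.trans ?_
        have : 0 ≤ rootRatio ψ s ω := Real.sqrt_nonneg _
        positivity
      · have := (hsq s ⟨hs.1.le, hs.2⟩ _ ⟨hx.1, hx1⟩).2
        rwa [critical_eq hν] at this
    have := pow_le_pow_left₀ h0 hle 2
    calc ν * ψ s (runningMax ψ s ω) ^ 2 / 2
        ≤ ν * (√2 / √ν * rootRatio ψ s ω + βp / (ν * (1 - s))) ^ 2 / 2 := by gcongr
      _ = ν * (√2 ^ 2 / √ν ^ 2 * rootRatio ψ s ω ^ 2 +
          2 * (√2 / √ν) * rootRatio ψ s ω * (βp / (ν * (1 - s))) + (βp / (ν * (1 - s))) ^ 2) / 2 := by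
        ring
      _ = _ := by
        simp only [div_pow, mul_pow, hν2, h22]
        field_simp
        ring

lemma Squeezed.le_meanMax {βm βp ν : ℝ} (hν : 0 < ν) (hβm : 0 < βm) {ψ : ℝ → ℝ → ℝ}
    (hψ : Feasible ψ) (hsq : Squeezed βm βp ν ψ) {t : ℝ} (ht : t ∈ Icc (0 : ℝ) 1) :
    -(3 * βm / √ν) ≤ meanMax ψ ν t - t := by
  have hν2 : √ν ^ 2 = ν := Real.sq_sqrt hν.le
  have h22 : √2 ^ 2 = 2 := Real.sq_sqrt (by norm_num)
  have hν0 : 0 < √ν := Real.sqrt_pos.2 hν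
  have h := lower_barrier (p := meanMax ψ ν) (γ := drift ψ ν) (b := βm * √2 / √ν) (by positivity)
    (intervalIntegrable_drift hν hψ (by simp) (by simp)) (fun s hs => (drift_mem hν hψ hs).1)
    (fun t ht => meanMax_eq hν hψ ht)
    (fun t _ => meanMax_le_one hν hψ t) (Eventually.of_forall fun s hs => ?_) ht
  · refine le_trans ?_ h
    -- The barrier gives `2√2 βm / √ν`; this rounds `2√2` up to `3`.
    have : √2 ≤ 3 / 2 := by
      rw [Real.sqrt_le_left (by norm_num)]
      norm_num
    rw [neg_le_neg_iff, ← mul_div_assoc]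
    refine div_le_div_of_nonneg_right ?_ hν0.le
    nlinarith
  · have hu : 0 < 1 - s := by linarith [hs.2]
    have hs' : s ∈ Icc (0 : ℝ) 1 := ⟨hs.1.le, hs.2.le⟩
    refine le_drift hν hψ ⟨hs.1.le, hs.2⟩ (by positivity) fun ω => ?_
    have hx := runningMax_mem ψ s ω
    have h0 := hψ.nonneg s hs' _ hx
    have hr : 0 ≤ rootRatio ψ s ω := Real.sqrt_nonneg _
    set Y := √2 / √ν * rootRatio ψ s ω with hY
    set k := βm / (ν * (1 - s)) with hk
    have hY0 : 0 ≤ Y := by positivity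
    have hk0 : 0 ≤ k := by positivity
    have hle : Y - k ≤ ψ s (runningMax ψ s ω) := by
      rcases hx.2.eq_or_lt with hx1 | hx1
      · have : Y = 0 := by simp [hY, rootRatio, hx1]
        linarith
      · have := (hsq s ⟨hs.1.le, hs.2⟩ _ ⟨hx.1, hx1⟩).1
        rwa [critical_eq hν] at this
    -- Squaring is legitimate only if `k ≤ Y`; otherwise the left side is already nonpositive.
    have hsq2 : Y ^ 2 - 2 * k * Y ≤ ψ s (runningMax ψ s ω) ^ 2 := by
      rcases le_total k Y with hkY | hkY
      · have := pow_le_pow_left₀ (sub_nonneg.2 hkY) hle 2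
        nlinarith [sq_nonneg k]
      · nlinarith [sq_nonneg (ψ s (runningMax ψ s ω))]
    have e : rootRatio ψ s ω ^ 2 - βm * √2 / √ν / (1 - s) * rootRatio ψ s ω =
        ν * (Y ^ 2 - 2 * k * Y) / 2 := by
      rw [hY, hk, mul_pow, div_pow, hν2, h22]
      field_simp
    rw [e]
    gcongr

/-- Below the critical curve the error terms are absent, and the barrier with `b = 0` is the
diagonal. -/
lemma IsOptimal.meanMax_le {ν : ℝ} (hν : 0 < ν) {ψ : ℝ → ℝ → ℝ} (hopt : IsOptimal ν ψ) {t : ℝ}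
    (ht : t ∈ Icc (0 : ℝ) 1) : meanMax ψ ν t ≤ t := by
  have hψ := hopt.1
  have hae := (ae_restrict_iff' measurableSet_Ioc).1 (hopt.ae_sq_le hν)
  have h := upper_barrier (p := meanMax ψ ν) (γ := drift ψ ν) (b := 0) le_rfl
    (intervalIntegrable_drift hν hψ (by simp) (by simp)) (fun t ht => meanMax_eq hν hψ ht)
    (fun t _ => meanMax_le_one hν hψ t) ?_ ht
  · simp at h
    exact h
  · filter_upwards [hae] with s hs hs1
    have hu : 0 < 1 - s := by linarith [hs1.2]
    refine drift_le hν hψ ⟨hs1.1.le, hs1.2⟩ (by simp) ?_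
    filter_upwards [hs ⟨hs1.1, hs1.2.le⟩] with ω hω
    have : ν * ψ s (runningMax ψ s ω) ^ 2 / 2 ≤ (1 - runningMax ψ s ω) / (1 - s) := by
      rw [le_div_iff₀ hu]
      linarith
    rw [rootRatio_sq hs1.2]
    simpa using this

end OnlineSelection

end

theorem mainTheorem4 :
    -- explicit bounds, with a threshold depending only on `β₋`, `β₊`, `c₊`
    (∀ βm βp cp : ℝ, 0 < βm → 0 ≤ βp → 2 - √3 < cp →
      ∃ ν₀ : ℝ, 0 < ν₀ ∧ ∀ ν : ℝ, ν₀ ≤ ν → ∀ ψ : ℝ → ℝ → ℝ,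
        OnlineSelection.Feasible ψ → OnlineSelection.Squeezed βm βp ν ψ →
          ∀ t ∈ Set.Icc (0 : ℝ) 1,
            -(3 * βm / √ν) ≤ OnlineSelection.meanMax ψ ν t - t ∧
            OnlineSelection.meanMax ψ ν t - t ≤
              βp * √2 * t / √ν + cp * βp ^ 2 / (2 * ν)) ∧
    -- the uniform rate, for every family of controls squeezed with fixed constants
    (∀ βm βp : ℝ, 0 < βm → 0 ≤ βp → ∀ ψ : ℝ → ℝ → ℝ → ℝ,
      (∀ᶠ ν in Filter.atTop,
        OnlineSelection.Feasible (ψ ν) ∧ OnlineSelection.Squeezed βm βp ν (ψ ν)) →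
      (fun ν : ℝ => ⨆ t : Set.Icc (0 : ℝ) 1, |OnlineSelection.meanMax (ψ ν) ν t - t|)
        =O[Filter.atTop] fun ν : ℝ => ν ^ (-(1 / 2) : ℝ)) ∧
    -- the optimal strategy
    (∀ ν : ℝ, 0 < ν → ∀ ψ : ℝ → ℝ → ℝ, OnlineSelection.IsOptimal ν ψ →
      ∀ t ∈ Set.Icc (0 : ℝ) 1, OnlineSelection.meanMax ψ ν t ≤ t) := by
  have hexp : ∀ βm βp cp : ℝ, 0 < βm → 0 ≤ βp → 2 - √3 < cp → ∀ ν : ℝ, 1 ≤ ν → ∀ ψ : ℝ → ℝ → ℝ,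
      OnlineSelection.Feasible ψ → OnlineSelection.Squeezed βm βp ν ψ →
        ∀ t ∈ Set.Icc (0 : ℝ) 1,
          -(3 * βm / √ν) ≤ OnlineSelection.meanMax ψ ν t - t ∧
          OnlineSelection.meanMax ψ ν t - t ≤
            βp * √2 * t / √ν + cp * βp ^ 2 / (2 * ν) := by
    intro βm βp cp hβm hβp hcp ν hν ψ hψ hsq t ht
    have hν0 : 0 < ν := by linarith
    refine ⟨hsq.le_meanMax hν0 hβm hψ ht, (hsq.meanMax_le hν0 hβp hψ ht).trans ?_⟩
    gcongr
  -- The threshold `1` only serves to make `ν` positive; the bounds do not need `ν` large.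
  refine ⟨fun βm βp cp hβm hβp hcp => ⟨1, one_pos, hexp βm βp cp hβm hβp hcp⟩, ?_,
    fun ν hν ψ hψ t ht => hψ.meanMax_le hν ht⟩
  intro βm βp hβm hβp ψ hev
  have hcp : 2 - √3 < 1 := by
    have : 1 < √3 := by rw [Real.lt_sqrt (by norm_num)]; norm_num
    linarith
  -- The constant comes from the explicit bounds with `cp = 1`, using `√ν ≤ ν` for `ν ≥ 1` to absorb
  -- the term of order `1/ν`.
  refine Asymptotics.IsBigO.of_bound (3 * βm + (βp * √2 + βp ^ 2)) ?_
  filter_upwards [hev, Filter.eventually_ge_atTop 1] with ν hψ hν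
  have hν0 : 0 < ν := by linarith
  have hs0 : 0 < √ν := Real.sqrt_pos.2 hν0
  have hpow : ν ^ (-(1 / 2) : ℝ) = 1 / √ν := by
    rw [Real.rpow_neg hν0.le, ← Real.sqrt_eq_rpow, one_div]
  rw [hpow, Real.norm_of_nonneg (Real.iSup_nonneg fun _ => abs_nonneg _),
    Real.norm_of_nonneg (by positivity)]
  refine ciSup_le fun t => ?_
  obtain ⟨h1, h2⟩ := hexp βm βp 1 hβm hβp hcp ν hν (ψ ν) hψ.1 hψ.2 t t.2
  have h3 : βp * √2 * t / √ν ≤ βp * √2 * (1 / √ν) := by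
    rw [mul_one_div]
    refine div_le_div_of_nonneg_right ?_ hs0.le
    exact mul_le_of_le_one_right (by positivity) t.2.2
  have h4 : 1 * βp ^ 2 / (2 * ν) ≤ βp ^ 2 * (1 / √ν) := by
    rw [one_mul, mul_one_div]
    gcongr
    have : √ν ≤ ν := by
      rw [Real.sqrt_le_left hν0.le]
      nlinarith
    linarith
  have h5 : 3 * βm / √ν = 3 * βm * (1 / √ν) := by ring
  have h6 : 0 ≤ 3 * βm * (1 / √ν) := by positivity
  have h7 : 0 ≤ (βp * √2 + βp ^ 2) * (1 / √ν) := by positivity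
  rw [abs_le]
  constructor <;> linarith
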